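/- Let $G$ be a connected finite-dimensional complex Lie group and let $f$ be a meromorphic function on $G$, that is, a global section of the sheaf of fractions of holomorphic functions: $f$ is locally a quotient $g/h$ of holomorphic functions, where the zero set of $h$ has empty interior, and any two of these local quotients $g/h$, $g'/h'$ satisfy $gh'=g'h$ where both are defined. Say that $f$ takes the value $w\in\mathbb P^1(\mathbb C)=\mathbb C\cup\{\infty\}$ at a point $x$ if near $x$ it can be written as $f=g/h$ in this way with $(g(x),h(x))\neq(0,0)$ and $w=[g(x):h(x)]$ (so poles have the value $\infty$, and at a point of indeterminacy $f$ takes no value). If there are three distinct points of $\mathbb P^1(\mathbb C)$ such that $f$ takes none of them as a value at any point of $G$, then $f$ is constant: there is $c\in\mathbb C$ with $f=c$ on $G$. -/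

import Mathlib

open scoped Manifold ContDiff

noncomputable section

/-- A local fraction on a complex manifold `M` modelled on `E`: a quotient `num / den` of two
holomorphic functions on an open set `source`, where the zero set of `den` has empty interior
in `source` (so `den` is a non-zero-divisor at every point of `source`).
Only the values of `num` and `den` on `source` matter. -/
structure LocalFraction (E : Type*) [NormedAddCommGroup E] [NormedSpace ℂ E]
    (M : Type*) [TopologicalSpace M] [ChartedSpace E M] where
  source : Set M
  num : M → ℂ
  den : M → ℂ
  isOpen_source : IsOpen source
  holomorphic_num : MDifferentiableOn 𝓘(ℂ, E) 𝓘(ℂ, ℂ) num source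
  holomorphic_den : MDifferentiableOn 𝓘(ℂ, E) 𝓘(ℂ, ℂ) den source
  dense_den_ne_zero : source ⊆ closure {x | x ∈ source ∧ den x ≠ 0}

namespace LocalFraction

variable {E : Type*} [NormedAddCommGroup E] [NormedSpace ℂ E]
  {M : Type*} [TopologicalSpace M] [ChartedSpace E M]

/-- Two local fractions agree on the intersection of their sources (cross-multiplication). -/
def Compatible (φ ψ : LocalFraction E M) : Prop :=
  ∀ x ∈ φ.source ∩ ψ.source, φ.num x * ψ.den x = ψ.num x * φ.den x

/-- The fraction determines a value in `ℙ¹(ℂ) = ℂ ∪ {∞}` at `x`: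
numerator and denominator do not both vanish there. -/
def IsDeterminateAt (φ : LocalFraction E M) (x : M) : Prop :=
  x ∈ φ.source ∧ (φ.num x ≠ 0 ∨ φ.den x ≠ 0)

open Classical in
/-- The point `[num x : den x]` of `ℙ¹(ℂ) = ℂ ∪ {∞}`; meaningful where `IsDeterminateAt` holds. -/
def value (φ : LocalFraction E M) (x : M) : OnePoint ℂ :=
  if φ.den x = 0 then OnePoint.infty else ((φ.num x / φ.den x : ℂ) : OnePoint ℂ)

/-- The value at a point does not depend on the fraction. -/
theorem Compatible.value_eq {φ ψ : LocalFraction E M} (h : φ.Compatible ψ) {x : M}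
    (hφ : φ.IsDeterminateAt x) (hψ : ψ.IsDeterminateAt x) : φ.value x = ψ.value x := by
  have e := h x ⟨hφ.1, hψ.1⟩
  obtain ⟨-, h1⟩ := hφ
  obtain ⟨-, h2⟩ := hψ
  unfold value
  by_cases a : φ.den x = 0 <;> by_cases b : ψ.den x = 0
  · simp [a, b]
  · simp_all
  · simp_all
  · simp only [a, b, if_false]
    rw [(div_eq_div_iff a b).2 e]

end LocalFraction

/-- A meromorphic function on a complex manifold `M`: a global section of the sheaf of fractions
of holomorphic functions. It is given by a family of pairwise compatible local fractions whose
sources cover `M`, and the family is taken maximal, so that equality is equality of sections. -/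
@[ext]
structure MeromorphicFunction (E : Type*) [NormedAddCommGroup E] [NormedSpace ℂ E]
    (M : Type*) [TopologicalSpace M] [ChartedSpace E M] where
  fractions : Set (LocalFraction E M)
  covers : ∀ x : M, ∃ φ ∈ fractions, x ∈ φ.source
  compatible : ∀ φ ∈ fractions, ∀ ψ ∈ fractions, φ.Compatible ψ
  maximal : ∀ ψ : LocalFraction E M, (∀ φ ∈ fractions, φ.Compatible ψ) → ψ ∈ fractions

namespace MeromorphicFunction

variable {E : Type*} [NormedAddCommGroup E] [NormedSpace ℂ E]
  {M : Type*} [TopologicalSpace M] [ChartedSpace E M]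

/-- `f` is defined at `x`, with value `w ∈ ℙ¹(ℂ) = ℂ ∪ {∞}`. Poles have the value `∞`;
at a point of indeterminacy `f` has no value. -/
def HasValueAt (f : MeromorphicFunction E M) (x : M) (w : OnePoint ℂ) : Prop :=
  ∃ φ ∈ f.fractions, φ.IsDeterminateAt x ∧ φ.value x = w

/-- `f` omits (avoids) the value `w`: it takes it at no point at which it is defined. -/
def Omits (f : MeromorphicFunction E M) (w : OnePoint ℂ) : Prop :=
  ∀ x : M, ¬ f.HasValueAt x w

/-- The fraction `c / 1` on all of `M`. -/
def constFraction (E : Type*) [NormedAddCommGroup E] [NormedSpace ℂ E]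
    (M : Type*) [TopologicalSpace M] [ChartedSpace E M] (c : ℂ) : LocalFraction E M where
  source := Set.univ
  num := fun _ => c
  den := fun _ => 1
  isOpen_source := isOpen_univ
  holomorphic_num := mdifferentiableOn_const
  holomorphic_den := mdifferentiableOn_const
  dense_den_ne_zero := by simp

/-- The constant meromorphic function `c`: all fractions `num / den` with `num = c * den`. -/
def const (E : Type*) [NormedAddCommGroup E] [NormedSpace ℂ E]
    (M : Type*) [TopologicalSpace M] [ChartedSpace E M] (c : ℂ) : MeromorphicFunction E M where
  fractions := {φ | ∀ x ∈ φ.source, φ.num x = c * φ.den x}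
  covers := fun x => ⟨constFraction E M c, by simp [constFraction], Set.mem_univ x⟩
  compatible := by
    intro φ hφ ψ hψ x hx
    rw [hφ x hx.1, hψ x hx.2]
    ring
  maximal := by
    intro ψ h x hx
    have := h (constFraction E M c) (by simp [constFraction]) x ⟨Set.mem_univ x, hx⟩
    simpa [constFraction] using this.symm

end MeromorphicFunction

end

/-! ### Bloch's and Landau's theorems in one variable. -/

section Landau

open Metric Set Complex

/-! A Möbius transformation sends two of the omitted values to `0` and `∞`, and scaling sends the
third to `1`. Two facts then suffice: a meromorphic function omitting `∞` is holomorphic, and a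
holomorphic function on `G` omitting `0` and `1` is constant.

The second fact (`MDifferentiable.exists_eq_const_of_omits`) needs no exponential map. If `c` is a
holomorphic disc of radius `r` with `c 0 = 1`, then `z ↦ x * c (z / N) ^ N` is a disc of radius `N *
r` through `x`, and `F` has the same derivative at `0` along all of these. Landau's theorem bounds
this derivative by `C / (N * r)` with `C` depending only on `F x`, so it vanishes. Every direction
at every point is reached by such a disc, hence `F` is locally constant.

The first fact (`IsPoleFree.locallyDivides`) is local: if no reduction of `u / v` takes the value
`∞`, then `v` divides `u`. It is proved without unique factorization of germs, by induction on the
order of `v` along a line. The tool is `locallyDivides_of_dense_lines`: a Cauchy integral over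
circles in parallel lines extends `u / v` as soon as it extends along a dense set of these lines.
Either `u / v` already extends at a dense set of the remaining points, which lie on a smooth
hypersurface, or somewhere `u` and `v` both vanish on a piece of that hypersurface; its equation
then cancels and the order drops. -/

/-- If `‖f'‖ ≤ 2 ‖f' a‖` on `ball a t`, then the image of `f` contains a disc of radius
`‖f' a‖ t / 24` about `f a`. -/
theorem ball_subset_image_of_norm_deriv_le {f : ℂ → ℂ} {a : ℂ} {t : ℝ} (ht : 0 < t)
    (hf : DifferentiableOn ℂ f (ball a t)) (h0 : deriv f a ≠ 0)
    (hb : ∀ z ∈ ball a t, ‖deriv f z‖ ≤ 2 * ‖deriv f a‖) :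
    ball (f a) (‖deriv f a‖ * t / 24) ⊆ f '' ball a t := by
  set m := ‖deriv f a‖ with hm
  have hm0 : 0 < m := norm_pos_iff.2 h0
  have ha : a ∈ ball a t := mem_ball_self ht
  have hfa : HasDerivAt f (deriv f a) a :=
    ((hf a ha).differentiableAt (isOpen_ball.mem_nhds ha)).hasDerivAt
  set k : ℂ → ℂ := fun z => f z - f a - deriv f a * (z - a) with hk
  have hka : k a = 0 := by simp [hk]
  have hkd : DifferentiableOn ℂ k (ball a t) := by
    have : DifferentiableOn ℂ (fun z => deriv f a * (z - a)) (ball a t) := by fun_prop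
    exact (hf.sub_const _).sub this
  have hmaps : MapsTo k (ball a t) (closedBall (k a) (3 * m * t)) := by
    intro z hz
    have h1 : ‖f z - f a‖ ≤ 2 * m * ‖z - a‖ :=
      (convex_ball a t).norm_image_sub_le_of_norm_deriv_le
        (fun x hx => (hf x hx).differentiableAt (isOpen_ball.mem_nhds hx)) hb ha hz
    have h2 : ‖z - a‖ < t := by simpa [dist_eq_norm] using hz
    rw [hka, mem_closedBall_zero_iff]
    calc ‖k z‖ ≤ ‖f z - f a‖ + ‖deriv f a * (z - a)‖ := norm_sub_le _ _
      _ ≤ 2 * m * ‖z - a‖ + m * ‖z - a‖ := by rw [norm_mul]; gcongr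
      _ = 3 * m * ‖z - a‖ := by ring
      _ ≤ 3 * m * t := by gcongr
  -- The remainder `k` vanishes to second order at `a`, so Schwarz's lemma gives `‖k z‖ ≤ 3 m t (‖z
  -- - a‖ / t) ^ 2`. On the circle of radius `t / 6` this is `m t / 12`, half the size of the linear
  -- term.
  have hlo : (k · - k a) =o[nhds a] (fun w => ‖w - a‖ ^ 1) := by
    have := hfa.isLittleO
    simp only [pow_one, hka, sub_zero]
    refine (this.congr_left fun w => ?_).norm_right
    simp [hk, mul_comm]
  have hball : closedBall a (t / 6) ⊆ ball a t := closedBall_subset_ball (by linarith)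
  have hsph : ∀ z ∈ sphere a (t / 6), m * t / 12 ≤ ‖f z - f a‖ := by
    intro z hz
    have hz' : ‖z - a‖ = t / 6 := by simpa [dist_eq_norm] using hz
    have h1 := dist_le_mul_div_pow_of_mapsTo_ball_of_isLittleO hkd hmaps hlo
      (hball (sphere_subset_closedBall hz))
    rw [hka, dist_zero_right, dist_eq_norm, hz'] at h1
    have e : 3 * m * t * (t / 6 / t) ^ (1 + 1) = m * t / 12 := by field_simp; norm_num
    have h2 : ‖deriv f a * (z - a)‖ = m * t / 6 := by rw [norm_mul, hz', ← hm]; ring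
    have h3 : ‖deriv f a * (z - a)‖ ≤ ‖f z - f a‖ + ‖k z‖ := by
      have : deriv f a * (z - a) = (f z - f a) - k z := by simp [hk]
      rw [this]; exact norm_sub_le _ _
    linarith
  have hfreq : ∃ᶠ z in nhds a, f z ≠ f a :=
    (hfa.eventually_ne h0 (c := f a)).frequently.filter_mono nhdsWithin_le_nhds
  have := DiffContOnCl.ball_subset_image_closedBall (f := f)
    ((hf.mono hball).diffContOnCl_ball subset_rfl) (by positivity) hsph hfreq
  rw [show m * t / 12 / 2 = m * t / 24 by ring] at this
  exact this.trans (image_mono hball)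

/-- **Bloch's theorem**, with a non-optimal constant. -/
theorem exists_ball_subset_image {f : ℂ → ℂ} {R : ℝ} (hR : 0 < R)
    (hf : DifferentiableOn ℂ f (ball 0 R)) (h0 : deriv f 0 ≠ 0) :
    ∃ w, ball w (‖deriv f 0‖ * R / 96) ⊆ f '' ball 0 R := by
  have hsub : closedBall (0 : ℂ) (R / 2) ⊆ ball 0 R := closedBall_subset_ball (by linarith)
  -- At a maximum `a` of this weighted derivative, halving the distance to the boundary at most
  -- doubles `‖f'‖`. Comparison with the value at `0` gives `‖f' a‖ t ≥ ‖f' 0‖ R / 4`, hence `96 = 4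
  -- * 24`.
  have hcont : ContinuousOn (fun z : ℂ => (R / 2 - ‖z‖) * ‖deriv f z‖) (closedBall 0 (R / 2)) := by
    refine ContinuousOn.mul (by fun_prop) ?_
    exact ((hf.deriv isOpen_ball).continuousOn.mono hsub).norm
  obtain ⟨a, ha, hmax⟩ := (isCompact_closedBall (0 : ℂ) (R / 2)).exists_isMaxOn
    ⟨0, by simp; linarith⟩ hcont
  have hmax' : ∀ z : ℂ, ‖z‖ ≤ R / 2 →
      (R / 2 - ‖z‖) * ‖deriv f z‖ ≤ (R / 2 - ‖a‖) * ‖deriv f a‖ := fun z hz =>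
    hmax (show z ∈ closedBall (0 : ℂ) (R / 2) by simpa using hz)
  have h00 := hmax' 0 (by simp; linarith)
  rw [norm_zero, sub_zero] at h00
  have hpos : 0 < (R / 2 - ‖a‖) * ‖deriv f a‖ :=
    lt_of_lt_of_le (mul_pos (by linarith) (norm_pos_iff.2 h0)) h00
  have ha' : ‖a‖ ≤ R / 2 := by simpa using ha
  have hta : 0 < R / 2 - ‖a‖ := by
    refine lt_of_le_of_ne (by linarith) fun h => ?_
    rw [← h, zero_mul] at hpos; exact lt_irrefl _ hpos
  set t := (R / 2 - ‖a‖) / 2 with ht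
  have ht0 : 0 < t := by positivity
  have hin : ∀ z ∈ ball a t, ‖z‖ ≤ ‖a‖ + t := by
    intro z hz
    have : ‖z - a‖ < t := by simpa [dist_eq_norm] using hz
    calc ‖z‖ = ‖a + (z - a)‖ := by ring_nf
      _ ≤ ‖a‖ + ‖z - a‖ := norm_add_le _ _
      _ ≤ _ := by linarith
  have hbR : ball a t ⊆ ball 0 R := fun z hz => by
    have := hin z hz
    rw [mem_ball_zero_iff]; linarith
  have hda : deriv f a ≠ 0 := fun h => by simp [h] at hpos
  have key := ball_subset_image_of_norm_deriv_le ht0 (hf.mono hbR) hda (by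
    intro z hz
    have h1 := hin z hz
    have h2 := hmax' z (by linarith)
    have h3 : t * ‖deriv f z‖ ≤ (R / 2 - ‖z‖) * ‖deriv f z‖ := by gcongr; linarith
    have h4 : t * ‖deriv f z‖ ≤ t * (2 * ‖deriv f a‖) := by
      rw [show t * (2 * ‖deriv f a‖) = (R / 2 - ‖a‖) * ‖deriv f a‖ by rw [ht]; ring]
      exact h3.trans h2
    exact le_of_mul_le_mul_left h4 ht0)
  refine ⟨f a, (ball_subset_ball ?_).trans (key.trans (image_mono hbR))⟩
  have : ‖deriv f a‖ * t = (R / 2 - ‖a‖) * ‖deriv f a‖ / 2 := by rw [ht]; ring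
  rw [this]; linarith

/-- Points where the complex cosine takes an integer value are `8`-dense in the plane. -/
theorem exists_norm_sub_lt_cos_eq_int (w : ℂ) : ∃ p : ℂ, ‖p - w‖ < 8 ∧ ∃ m : ℤ, cos p = m := by
  have hπ := Real.pi_pos
  have hπ4 := Real.pi_le_four
  set k : ℤ := round (w.re / (2 * Real.pi)) with hk
  have hre : |w.re - k * (2 * Real.pi)| ≤ Real.pi := by
    have h := abs_sub_round (w.re / (2 * Real.pi))
    have : w.re - k * (2 * Real.pi) = (w.re / (2 * Real.pi) - k) * (2 * Real.pi) := by
      field_simp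
    rw [this, abs_mul, abs_of_pos (by positivity : 0 < 2 * Real.pi)]
    nlinarith
  obtain ⟨s, hs1, m, hs2⟩ : ∃ s : ℝ, |s - w.im| ≤ 2 ∧ ∃ m : ℤ, Real.cosh s = m := by
    suffices H : ∀ y : ℝ, 0 ≤ y → ∃ s : ℝ, |s - y| ≤ 2 ∧ ∃ m : ℤ, Real.cosh s = m by
      rcases le_total 0 w.im with h | h
      · exact H _ h
      · obtain ⟨s, h1, m, h2⟩ := H (-w.im) (by linarith)
        refine ⟨-s, ?_, m, by rwa [Real.cosh_neg]⟩
        rw [← abs_neg]; convert h1 using 2; ring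
    intro y hy
    -- Rounding `cosh y` down to an integer at most halves it, as `m + 1 ≤ 2 m`; this moves `y` by
    -- at most `2`, because `e ^ 2 ≥ 4`.
    set m : ℤ := ⌊Real.cosh y⌋ with hm
    have hm1 : (1 : ℝ) ≤ m := by
      have : (1 : ℤ) ≤ m := Int.le_floor.2 (by simp)
      exact_mod_cast this
    have hm2 : (m : ℝ) ≤ Real.cosh y := Int.floor_le _
    have hm3 : Real.cosh y < m + 1 := Int.lt_floor_add_one _
    obtain ⟨s, ⟨hs0, hsy⟩, hs⟩ := intermediate_value_Icc hy Real.continuous_cosh.continuousOn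
      (show (m : ℝ) ∈ Icc (Real.cosh 0) (Real.cosh y) by simp [hm1, hm2])
    refine ⟨s, ?_, m, hs⟩
    rw [abs_sub_comm, abs_of_nonneg (by linarith)]
    by_contra! hcon
    have h1 : Real.exp y / 2 ≤ Real.cosh y := by
      rw [Real.cosh_eq]; linarith [Real.exp_pos (-y)]
    have h2 : Real.cosh s ≤ Real.exp s := by
      rw [Real.cosh_eq]
      have : Real.exp (-s) ≤ Real.exp s := Real.exp_le_exp.2 (by linarith)
      linarith
    have h3 : Real.exp y < 4 * Real.exp s := by linarith
    have h4 : Real.exp (s + 2) < Real.exp y := Real.exp_lt_exp.2 (by linarith)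
    rw [Real.exp_add] at h4
    have h5 : (4 : ℝ) ≤ Real.exp 2 := by
      have := Real.add_one_le_exp (1 : ℝ)
      have e : Real.exp 2 = Real.exp 1 * Real.exp 1 := by rw [← Real.exp_add]; norm_num
      rw [e]; nlinarith
    nlinarith [Real.exp_pos s]
  refine ⟨(s : ℂ) * I + k * (2 * Real.pi), ?_, m, ?_⟩
  · refine (norm_le_abs_re_add_abs_im _).trans_lt ?_
    have h1 : ((s : ℂ) * I + k * (2 * Real.pi) - w).re = -(w.re - k * (2 * Real.pi)) := by simp
    have h2 : ((s : ℂ) * I + k * (2 * Real.pi) - w).im = s - w.im := by simp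
    rw [h1, h2, abs_neg]
    linarith
  · rw [cos_add_int_mul_two_pi, cos_mul_I, ← ofReal_cosh, hs2]; simp

/-- A zero-free holomorphic function on a disc has a holomorphic logarithm, with prescribed value
at the centre. -/
theorem exists_differentiableOn_exp_eq {f : ℂ → ℂ} {R : ℝ} (hR : 0 < R)
    (hf : DifferentiableOn ℂ f (ball 0 R)) (h0 : ∀ z ∈ ball (0 : ℂ) R, f z ≠ 0) {l : ℂ}
    (hl : exp l = f 0) :
    ∃ g : ℂ → ℂ, g 0 = l ∧ DifferentiableOn ℂ g (ball 0 R) ∧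
      ∀ z ∈ ball (0 : ℂ) R, exp (g z) = f z := by
  -- The logarithm is a primitive `g` of `f' / f`: then `exp (-g) * f` has zero derivative.
  have hd : DifferentiableOn ℂ (fun z => deriv f z / f z) (ball 0 R) :=
    (hf.deriv isOpen_ball).div hf h0
  obtain ⟨g, hg0, hg⟩ := hd.isExactOn_ball.with_val_at 0 l
  have hgd : DifferentiableOn ℂ g (ball 0 R) := fun z hz =>
    (hg z hz).differentiableAt.differentiableWithinAt
  refine ⟨g, hg0, hgd, fun z hz => ?_⟩
  have hder : ∀ x ∈ ball (0 : ℂ) R, HasDerivAt (fun z => exp (-g z) * f z) 0 x := by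
    intro x hx
    have h1 : HasDerivAt f (deriv f x) x :=
      ((hf x hx).differentiableAt (isOpen_ball.mem_nhds hx)).hasDerivAt
    have h2 := ((hg x hx).neg.cexp).mul h1
    refine h2.congr_deriv ?_
    linear_combination -exp (-g x) * div_mul_cancel₀ (deriv f x) (h0 x hx)
  have hc := (convex_ball (0 : ℂ) R).is_const_of_fderivWithin_eq_zero (𝕜 := ℂ)
    (fun x hx => (hder x hx).differentiableAt.differentiableWithinAt)
    (fun x hx => by
      rw [fderivWithin_of_isOpen isOpen_ball hx]
      ext; simpa using (hder x hx).deriv) hz (mem_ball_self hR)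
  simp only [hg0, ← hl, ← exp_add] at hc
  rw [neg_add_cancel, exp_zero, exp_neg, inv_mul_eq_one₀ (exp_ne_zero _)] at hc
  exact hc

/-- If the cosine of a holomorphic function on a disc of radius `R` avoids the integers, then the
derivative of the function at the centre is at most `768 / R`. -/
theorem norm_deriv_mul_le_of_cos_ne_int {h : ℂ → ℂ} {R : ℝ} (hR : 0 < R)
    (hd : DifferentiableOn ℂ h (ball 0 R)) (hc : ∀ z ∈ ball (0 : ℂ) R, ∀ m : ℤ, cos (h z) ≠ m) :
    ‖deriv h 0‖ * R ≤ 768 := by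
  by_contra! hcon
  have h0 : deriv h 0 ≠ 0 := fun h => by simp [h] at hcon; linarith
  obtain ⟨w, hw⟩ := exists_ball_subset_image hR hd h0
  obtain ⟨p, hp, m, hm⟩ := exists_norm_sub_lt_cos_eq_int w
  -- The constant is `768 = 96 * 8`: a larger derivative yields a Bloch disc of radius above `8`,
  -- which contains a point with integral cosine.
  obtain ⟨z, hz, rfl⟩ := hw (show p ∈ ball w _ by rw [mem_ball, dist_eq_norm]; linarith)
  exact hc z hz m hm

/-- **Landau's theorem**: the derivative at the centre of a holomorphic function on a disc of
radius `R` omitting `0` and `1` is bounded by `C / R`, where `C` depends only on the value at the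
centre. -/
theorem exists_norm_deriv_mul_le_of_omits (a : ℂ) : ∃ C : ℝ, ∀ (R : ℝ) (F : ℂ → ℂ), 0 < R →
    DifferentiableOn ℂ F (ball 0 R) → F 0 = a →
    (∀ z ∈ ball (0 : ℂ) R, F z ≠ 0 ∧ F z ≠ 1) → ‖deriv F 0‖ * R ≤ C := by
  -- The proof writes `F = exp (2πi cos h)`. The branches used to build `h` get their central values
  -- from `a` alone, so the final bound depends only on `a`.
  set g₀ := log a / (2 * Real.pi * I) with hg₀
  set s₀ := log (g₀ ^ 2 - 1) with hs₀
  set h₀ := -I * log (g₀ + exp (s₀ / 2)) with hh₀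
  refine ⟨‖2 * Real.pi * I * a * sin h₀‖ * 768, fun R F hR hF hFa hom => ?_⟩
  have hmem : (0 : ℂ) ∈ ball (0 : ℂ) R := mem_ball_self hR
  have ha : a ≠ 0 := hFa ▸ (hom 0 hmem).1
  have hpi : (2 * Real.pi * I : ℂ) ≠ 0 := by simp [Real.pi_ne_zero]
  obtain ⟨L, hL0, hLd, hL⟩ := exists_differentiableOn_exp_eq hR hF (fun z hz => (hom z hz).1)
    (l := log a) (by rw [exp_log ha, hFa])
  set G : ℂ → ℂ := fun z => L z / (2 * Real.pi * I) with hG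
  have hGd : DifferentiableOn ℂ G (ball 0 R) := hLd.div_const _
  have hG0 : G 0 = g₀ := by simp [hG, hL0, hg₀]
  have hGF : ∀ z ∈ ball (0 : ℂ) R, F z = exp (2 * Real.pi * I * G z) := by
    intro z hz
    rw [← hL z hz, hG]; congr 1; field_simp
  have hGint : ∀ z ∈ ball (0 : ℂ) R, ∀ m : ℤ, G z ≠ m := by
    intro z hz m hm
    apply (hom z hz).2
    rw [hGF z hz, hm, exp_eq_one_iff]
    exact ⟨m, by ring⟩
  have hG2 : ∀ z ∈ ball (0 : ℂ) R, G z ^ 2 - 1 ≠ 0 := by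
    intro z hz hcon
    rw [sub_eq_zero, sq_eq_one_iff] at hcon
    rcases hcon with h | h
    · exact hGint z hz 1 (by simpa using h)
    · exact hGint z hz (-1) (by simpa using h)
  obtain ⟨S, hS0, hSd, hS⟩ := exists_differentiableOn_exp_eq hR
    (f := fun z => G z ^ 2 - 1) ((hGd.pow 2).sub_const 1) hG2
    (l := s₀) (by rw [hs₀, exp_log (hG0 ▸ hG2 0 hmem), hG0])
  set T : ℂ → ℂ := fun z => exp (S z / 2) with hT
  have hTd : DifferentiableOn ℂ T (ball 0 R) := (hSd.div_const 2).cexp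
  have hT2 : ∀ z ∈ ball (0 : ℂ) R, T z ^ 2 = G z ^ 2 - 1 := by
    intro z hz
    rw [hT, ← hS z hz, ← exp_nat_mul]; congr 1; push_cast; ring
  -- With `T = √(G ^ 2 - 1)`, the factors `G ± T` are inverse to each other, so they are `exp (± i
  -- h)` and their half-sum is `cos h = G`.
  have hGT : ∀ z ∈ ball (0 : ℂ) R, (G z + T z) * (G z - T z) = 1 := by
    intro z hz; linear_combination -(hT2 z hz)
  have hne : ∀ z ∈ ball (0 : ℂ) R, G z + T z ≠ 0 := fun z hz h => by
    have := hGT z hz; simp [h] at this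
  obtain ⟨K, hK0, hKd, hK⟩ := exists_differentiableOn_exp_eq hR (f := fun z => G z + T z)
    (hGd.add hTd) hne (l := log (g₀ + exp (s₀ / 2))) (by
      have h1 := hne 0 hmem
      simp only [hT, hG0, hS0] at h1 ⊢
      rw [exp_log h1])
  set h : ℂ → ℂ := fun z => -I * K z with hh
  have hhd : DifferentiableOn ℂ h (ball 0 R) := hKd.const_mul _
  have hcos : ∀ z ∈ ball (0 : ℂ) R, cos (h z) = G z := by
    intro z hz
    have e1 : h z * I = K z := by simp only [hh]; linear_combination (-K z) * I_mul_I
    have e2 : -h z * I = -K z := by rw [neg_mul, e1]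
    rw [cos, e1, e2, exp_neg, hK z hz, show (G z + T z)⁻¹ = G z - T z from
      inv_eq_of_mul_eq_one_right (hGT z hz)]
    ring
  have hb := norm_deriv_mul_le_of_cos_ne_int hR hhd (fun z hz m => hcos z hz ▸ hGint z hz m)
  have hder : deriv F 0 = 2 * Real.pi * I * a * -(sin h₀ * deriv h 0) := by
    have hd1 : HasDerivAt h (deriv h 0) 0 :=
      ((hhd 0 hmem).differentiableAt (isOpen_ball.mem_nhds hmem)).hasDerivAt
    have hd2 := (hd1.ccos.const_mul (2 * Real.pi * I : ℂ)).cexp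
    have hev : F =ᶠ[nhds 0] fun z => exp (2 * Real.pi * I * cos (h z)) := by
      filter_upwards [isOpen_ball.mem_nhds hmem] with z hz
      rw [hcos z hz, hGF z hz]
    rw [(hd2.congr_of_eventuallyEq hev).deriv, hcos 0 hmem, ← hGF 0 hmem, hFa]
    have : h 0 = h₀ := by simp [hh, hK0, hh₀]
    rw [this]; ring
  rw [hder, mul_neg, norm_neg, ← mul_assoc, norm_mul, mul_assoc]
  gcongr

end Landau

/-! ### Holomorphic functions of several variables along complex lines. -/

section Lines

open Metric Set Filter Topology

variable {E : Type*} [NormedAddCommGroup E] [NormedSpace ℂ E]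

/-- The quotient `u / v` extends to a holomorphic function near `p`. -/
def LocallyDivides (v u : E → ℂ) (p : E) : Prop :=
  ∃ q : E → ℂ, ∀ᶠ y in 𝓝 p, DifferentiableAt ℂ q y ∧ u y = q y * v y

theorem LocallyDivides.congr {v u v' u' : E → ℂ} {p : E} (h : LocallyDivides v u p)
    (hk : ∃ k : E → ℂ, ∀ᶠ y in 𝓝 p, v' y = k y * v y ∧ u' y = k y * u y) :
    LocallyDivides v' u' p := by
  obtain ⟨q, hq⟩ := h
  obtain ⟨k, hk⟩ := hk
  refine ⟨q, ?_⟩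
  filter_upwards [hq, hk] with y hy hy'
  exact ⟨hy.1, by rw [hy'.1, hy'.2, hy.2]; ring⟩

theorem locallyDivides_of_ne_zero {v u : E → ℂ} {W : Set E} {p : E} (hW : W ∈ 𝓝 p)
    (hu : ∀ y ∈ W, DifferentiableAt ℂ u y) (hv : ∀ y ∈ W, DifferentiableAt ℂ v y)
    (h0 : v p ≠ 0) : LocallyDivides v u p := by
  refine ⟨fun y => u y * (v y)⁻¹, ?_⟩
  filter_upwards [hW, (hv p (mem_of_mem_nhds hW)).continuousAt.eventually_ne h0] with y hy hy'
  exact ⟨(hu y hy).mul ((hv y hy).fun_inv hy'), (inv_mul_cancel_right₀ hy' _).symm⟩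

/-- Local quotients by a function with dense support glue to one holomorphic function. -/
theorem exists_glued_quotient (v u : E → ℂ) : ∃ Q : E → ℂ, ∀ x, LocallyDivides v u x →
    (∀ᶠ y in 𝓝 x, ContinuousAt v y ∧ ∃ᶠ z in 𝓝 y, v z ≠ 0) →
    DifferentiableAt ℂ Q x ∧ u x = Q x * v x := by
  classical
  refine ⟨fun x => if h : LocallyDivides v u x then h.choose x else 0, fun x hx hd => ?_⟩
  obtain ⟨q, hq⟩ := id hx
  have hQ : (fun x => if h : LocallyDivides v u x then h.choose x else 0) =ᶠ[𝓝 x] q := by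
    filter_upwards [hq.eventually_nhds, hd] with y hy hdy
    have hy' : LocallyDivides v u y := ⟨q, hy⟩
    rw [dif_pos hy']
    -- Two local quotients that differ at `y` differ near `y`, hence at a point where `v ≠ 0`, which
    -- is impossible.
    by_contra hne
    have h1 := hy'.choose_spec
    have h2 : ∀ᶠ z in 𝓝 y, hy'.choose z - q z ≠ 0 :=
      (h1.self_of_nhds.1.continuousAt.sub hy.self_of_nhds.1.continuousAt).eventually_ne
        (sub_ne_zero.2 hne)
    obtain ⟨z, hz, hz1, hz2, hz3⟩ := (hdy.2.and_eventually (h1.and (hy.and h2))).exists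
    have : (hy'.choose z - q z) * v z = 0 := by rw [sub_mul, ← hz1.2, ← hz2.2, sub_self]
    exact (mul_ne_zero hz3 hz) this
  refine ⟨hQ.differentiableAt_iff.2 hq.self_of_nhds.1, ?_⟩
  rw [hQ.self_of_nhds]
  exact hq.self_of_nhds.2

theorem hasDerivAt_line (y e : E) (ζ : ℂ) : HasDerivAt (fun ζ : ℂ => y + ζ • e) e ζ := by
  simpa using ((hasDerivAt_id ζ).smul_const e).const_add y

theorem DifferentiableAt.comp_line {f : E → ℂ} {y e : E} {ζ : ℂ}
    (hf : DifferentiableAt ℂ f (y + ζ • e)) : DifferentiableAt ℂ (fun ζ : ℂ => f (y + ζ • e)) ζ :=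
  hf.comp ζ (hasDerivAt_line y e ζ).differentiableAt

/-- A closed disc in a complex line contained in an open set stays in it under small
translations. -/
theorem eventually_forall_line_mem {W : Set E} (hW : IsOpen W) {p e : E} {K : Set ℂ}
    (hK : IsCompact K) (h : ∀ ζ ∈ K, p + ζ • e ∈ W) :
    ∀ᶠ y in 𝓝 p, ∀ ζ ∈ K, y + ζ • e ∈ W := by
  refine hK.eventually_forall_of_forall_eventually fun ζ hζ => ?_
  have hc : Continuous fun x : E × ℂ => x.1 + x.2 • e := by fun_prop
  exact hc.continuousAt.eventually (hW.mem_nhds (h ζ hζ))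

theorem analyticAt_line {W : Set E} (hW : IsOpen W) {f : E → ℂ} (hf : DifferentiableOn ℂ f W)
    {y e : E} {ζ : ℂ} (h : y + ζ • e ∈ W) : AnalyticAt ℂ (fun ζ : ℂ => f (y + ζ • e)) ζ := by
  rw [Complex.analyticAt_iff_eventually_differentiableAt]
  filter_upwards [(hasDerivAt_line y e ζ).continuousAt.eventually (hW.mem_nhds h)] with s hs
  exact ((hf _ hs).differentiableAt (hW.mem_nhds hs)).comp_line

/-- The derivative of `f` in the direction `e`. -/
noncomputable def dirDeriv (e : E) (f : E → ℂ) (y : E) : ℂ := deriv (fun ζ : ℂ => f (y + ζ • e)) 0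

theorem dirDeriv_line (e : E) (f : E → ℂ) (y : E) (ζ : ℂ) :
    dirDeriv e f (y + ζ • e) = deriv (fun s : ℂ => f (y + s • e)) ζ := by
  have := deriv_comp_const_add (fun s : ℂ => f (y + s • e)) ζ 0
  rw [add_zero] at this
  rw [← this, dirDeriv]
  congr 1; ext s; congr 1; module

theorem iterate_dirDeriv_line (e : E) (f : E → ℂ) (y : E) (n : ℕ) (ζ : ℂ) :
    (dirDeriv e)^[n] f (y + ζ • e) = iteratedDeriv n (fun s : ℂ => f (y + s • e)) ζ := by
  induction n generalizing ζ with
  | zero => simp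
  | succ n ih =>
    rw [Function.iterate_succ_apply', dirDeriv_line, iteratedDeriv_succ]
    congr 1; ext s; exact ih s

theorem iterate_dirDeriv (e : E) (f : E → ℂ) (y : E) (n : ℕ) :
    (dirDeriv e)^[n] f y = iteratedDeriv n (fun s : ℂ => f (y + s • e)) 0 := by
  simpa using iterate_dirDeriv_line e f y n 0

variable [FiniteDimensional ℂ E]

/-- Integrals of a holomorphic function of several variables over circles in complex lines depend
holomorphically on the base point. -/
theorem differentiableAt_circleIntegral_line {W : Set E} (hW : IsOpen W) {f : E → ℂ}
    (hf : DifferentiableOn ℂ f W) {c : ℂ → ℂ} {r : ℝ} (hr : 0 ≤ r)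
    (hc : ContinuousOn c (sphere 0 r)) {p e : E} (hp : ∀ ζ ∈ sphere (0 : ℂ) r, p + ζ • e ∈ W) :
    DifferentiableAt ℂ (fun y => ∮ ζ in C(0, r), c ζ * f (y + ζ • e)) p := by
  have : ProperSpace E := FiniteDimensional.proper ℂ E
  borelize E
  set K : Set E := (fun ζ : ℂ => p + ζ • e) '' sphere 0 r with hKdef
  have hlc : Continuous fun ζ : ℂ => p + ζ • e := by fun_prop
  have hK : IsCompact K := (isCompact_sphere 0 r).image hlc
  -- On a compact thickening of the circle `f` is bounded; Cauchy's estimate on balls of radius `δ /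
  -- 2` then dominates the derivative of the integrand by a constant.
  obtain ⟨δ, hδ, hδW⟩ := hK.exists_cthickening_subset_open hW (by
    rintro _ ⟨ζ, hζ, rfl⟩; exact hp ζ hζ)
  have hT : IsCompact (cthickening δ K) := hK.cthickening
  obtain ⟨M, hM⟩ := hT.exists_bound_of_continuousOn (hf.continuousOn.mono hδW)
  have hcirc : ∀ θ : ℝ, circleMap 0 r θ ∈ sphere (0 : ℂ) r := circleMap_mem_sphere 0 hr
  have hmem : ∀ ζ ∈ sphere (0 : ℂ) r, ∀ y ∈ ball p (δ / 2), ball (y + ζ • e) (δ / 2) ⊆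
      cthickening δ K := by
    intro ζ hζ y hy z hz
    refine mem_cthickening_of_dist_le z (p + ζ • e) δ K ⟨ζ, hζ, rfl⟩ ?_
    calc dist z (p + ζ • e) ≤ dist z (y + ζ • e) + dist (y + ζ • e) (p + ζ • e) :=
          dist_triangle _ _ _
      _ ≤ δ / 2 + δ / 2 := by
          rw [dist_add_right]
          exact add_le_add (le_of_lt hz) (le_of_lt hy)
      _ = δ := by ring
  have hin : ∀ ζ ∈ sphere (0 : ℂ) r, ∀ y ∈ ball p (δ / 2), y + ζ • e ∈ W := fun ζ hζ y hy =>
    hδW (hmem ζ hζ y hy (mem_ball_self (by positivity)))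
  have hbd : ∀ ζ ∈ sphere (0 : ℂ) r, ∀ y ∈ ball p (δ / 2),
      ‖fderiv ℂ f (y + ζ • e)‖ ≤ 2 * M / (δ / 2) := by
    intro ζ hζ y hy
    have hs := hmem ζ hζ y hy
    refine Complex.norm_fderiv_le_div_of_mapsTo_ball (hf.mono (hs.trans hδW)) ?_ (by positivity)
    intro z hz
    rw [mem_closedBall, dist_eq_norm]
    have h1 := hM z (hs hz)
    have h2 := hM _ (hs (mem_ball_self (by positivity)))
    exact (norm_sub_le _ _).trans (by linarith)
  obtain ⟨C, hC⟩ := (isCompact_sphere (0 : ℂ) r).exists_bound_of_continuousOn hc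
  set a : ℝ → ℂ := fun θ => deriv (circleMap 0 r) θ * c (circleMap 0 r θ) with ha
  have hac : Continuous a := by
    refine Continuous.mul ?_ (hc.comp_continuous (continuous_circleMap 0 r) hcirc)
    have : deriv (circleMap 0 r) = fun θ => circleMap 0 r θ * Complex.I := by
      ext θ; simp
    rw [this]; fun_prop
  have hab : ∀ θ, ‖a θ‖ ≤ r * C := by
    intro θ
    rw [ha, norm_mul, deriv_circleMap, norm_mul, Complex.norm_I, mul_one]
    have := hC _ (hcirc θ)
    have h2 : ‖circleMap 0 r θ‖ = r := by simpa using hcirc θ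
    rw [h2]
    gcongr
  have hFc : ∀ y ∈ ball p (δ / 2), Continuous fun θ : ℝ => a θ * f (y + circleMap 0 r θ • e) := by
    intro y hy
    refine hac.mul (hf.continuousOn.comp_continuous (by fun_prop) fun θ => ?_)
    exact hin _ (hcirc θ) y hy
  have hpball : p ∈ ball p (δ / 2) := mem_ball_self (by positivity)
  have hnhds : ball p (δ / 2) ∈ 𝓝 p := isOpen_ball.mem_nhds hpball
  have key := intervalIntegral.hasFDerivAt_integral_of_dominated_of_fderiv_le
    (𝕜 := ℂ) (μ := MeasureTheory.volume) (a := 0) (b := 2 * Real.pi) (s := ball p (δ / 2))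
    (F := fun y θ => a θ * f (y + circleMap 0 r θ • e))
    (F' := fun y θ => a θ • fderiv ℂ f (y + circleMap 0 r θ • e))
    (x₀ := p) (bound := fun _ => r * C * (2 * M / (δ / 2))) hnhds
    (by filter_upwards [hnhds] with y hy using (hFc y hy).aestronglyMeasurable)
    ((hFc p hpball).intervalIntegrable _ _)
    (by
      refine Measurable.aestronglyMeasurable ?_
      refine hac.measurable.smul ((measurable_fderiv ℂ f).comp ?_)
      exact Continuous.measurable (by fun_prop))
    (MeasureTheory.ae_of_all _ fun θ _ y hy => by
      rw [norm_smul]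
      have := hbd _ (hcirc θ) y hy
      have h2 := hab θ
      have h3 : 0 ≤ r * C := (norm_nonneg _).trans h2
      gcongr)
    intervalIntegrable_const
    (MeasureTheory.ae_of_all _ fun θ _ y hy => by
      have hyW := hin _ (hcirc θ) y hy
      have h1 := ((hf _ hyW).differentiableAt (hW.mem_nhds hyW)).hasFDerivAt
      have h2 : HasFDerivAt (fun y : E => y + circleMap 0 r θ • e) (.id ℂ E) y :=
        (hasFDerivAt_id y).add_const _
      have h3 := (h1.comp y h2).const_mul (a θ)
      simpa using h3)
  refine key.differentiableAt.congr_of_eventuallyEq (Eventually.of_forall fun y => ?_)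
  simp only [circleIntegral, ha, smul_eq_mul, mul_assoc]

/-- Cauchy's formula for the derivative expresses it near each point as a circle integral of the
kind treated above. -/
theorem DifferentiableOn.dirDeriv {W : Set E} (hW : IsOpen W) {f : E → ℂ}
    (hf : DifferentiableOn ℂ f W) (e : E) : DifferentiableOn ℂ (dirDeriv e f) W := by
  intro p hp
  have hlc : Continuous fun ζ : ℂ => p + ζ • e := by fun_prop
  obtain ⟨r, hr, hrW⟩ := Metric.nhds_basis_closedBall.mem_iff.1
    ((hW.preimage hlc).mem_nhds (show (0 : ℂ) ∈ _ by simpa using hp))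
  have hev := eventually_forall_line_mem hW (p := p) (e := e) (isCompact_closedBall (0 : ℂ) r)
    (fun ζ hζ => hrW hζ)
  have hd := differentiableAt_circleIntegral_line hW hf (c := fun ζ => ((ζ - 0) ^ 2)⁻¹) hr.le
    (by
      refine ContinuousOn.inv₀ (by fun_prop) fun ζ hζ => ?_
      have : ζ ≠ 0 := by rintro rfl; simp at hζ; linarith
      simpa using this) (p := p) (e := e) fun ζ hζ => hrW (sphere_subset_closedBall hζ)
  refine DifferentiableAt.differentiableWithinAt
    ((hd.const_mul (2 * Real.pi * Complex.I)⁻¹).congr_of_eventuallyEq ?_)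
  filter_upwards [hev] with y hy
  have hlcy : Continuous fun ζ : ℂ => y + ζ • e := by fun_prop
  have := Complex.two_pi_I_inv_smul_circleIntegral_sub_sq_inv_smul_of_differentiable
    (hW.preimage hlcy) (c := 0) (w₀ := 0) (R := r) (f := fun ζ => f (y + ζ • e)) hy
    (fun ζ hζ => ((hf _ hζ).differentiableAt (hW.mem_nhds hζ)).comp_line.differentiableWithinAt)
    (mem_ball_self hr)
  simpa only [smul_eq_mul, _root_.dirDeriv] using this.symm

theorem DifferentiableOn.iterate_dirDeriv {W : Set E} (hW : IsOpen W) {f : E → ℂ}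
    (hf : DifferentiableOn ℂ f W) (e : E) (n : ℕ) :
    DifferentiableOn ℂ ((_root_.dirDeriv e)^[n] f) W := by
  induction n with
  | zero => exact hf
  | succ n ih => rw [Function.iterate_succ_apply']; exact ih.dirDeriv hW e

end Lines

/-! ### Extending a quotient from parallel lines. -/

section LocalQuotient

open Metric Set Filter Topology

variable {E : Type*} [NormedAddCommGroup E] [NormedSpace ℂ E]

/-- A function analytic at all points of a closed disc and nonzero at one of them is nonzero at
points arbitrarily close to every point near the disc. -/
theorem eventually_frequently_ne_zero {f : ℂ → ℂ} {r : ℝ}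
    (hf : AnalyticOnNhd ℂ f (closedBall 0 r)) {ζ₀ : ℂ} (hζ₀ : ζ₀ ∈ closedBall (0 : ℂ) r)
    (h0 : f ζ₀ ≠ 0) {ζ : ℂ} (hζ : ζ ∈ closedBall (0 : ℂ) r) :
    ∀ᶠ s in 𝓝 ζ, ContinuousAt f s ∧ ∃ᶠ z in 𝓝 s, f z ≠ 0 := by
  have hne : ∀ᶠ z in 𝓝[≠] ζ, f z ≠ 0 := by
    refine (hf ζ hζ).eventually_eq_zero_or_eventually_ne_zero.resolve_left fun h => h0 ?_
    exact hf.eqOn_zero_of_preconnected_of_eventuallyEq_zero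
      (convex_closedBall (0 : ℂ) r).isPreconnected hζ h hζ₀
  filter_upwards [(hf ζ hζ).eventually_analyticAt, eventually_nhdsWithin_iff.1 hne] with s hs hs'
  refine ⟨hs.continuousAt, ?_⟩
  rcases eq_or_ne s ζ with rfl | h
  · exact hne.frequently.filter_mono nhdsWithin_le_nhds
  · exact (hs.continuousAt.eventually_ne (hs' h)).frequently

theorem LocallyDivides.line {v u : E → ℂ} {y e : E} {ζ : ℂ}
    (h : LocallyDivides v u (y + ζ • e)) :
    LocallyDivides (fun s : ℂ => v (y + s • e)) (fun s : ℂ => u (y + s • e)) ζ := by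
  obtain ⟨q, hq⟩ := h
  refine ⟨fun s => q (y + s • e), ?_⟩
  filter_upwards [(hasDerivAt_line y e ζ).continuousAt.eventually hq] with s hs
  exact ⟨hs.1.comp_line, hs.2⟩

/-- In one variable, a function vanishing at a simple zero of `g` is locally divisible by `g`. -/
theorem locallyDivides_of_deriv_ne_zero {f g : ℂ → ℂ} {ζ : ℂ} (hf : AnalyticAt ℂ f ζ)
    (hg : AnalyticAt ℂ g ζ) (hf0 : f ζ = 0) (hg0 : g ζ = 0) (hg' : deriv g ζ ≠ 0) :
    LocallyDivides g f ζ := by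
  obtain ⟨s, hs, hsf, hsg⟩ : ∃ s ∈ 𝓝 ζ, DifferentiableOn ℂ f s ∧ DifferentiableOn ℂ g s := by
    refine ⟨_, Filter.inter_mem (Complex.analyticAt_iff_eventually_differentiableAt.1 hf)
      (Complex.analyticAt_iff_eventually_differentiableAt.1 hg), ?_, ?_⟩
    · exact fun x hx => hx.1.differentiableWithinAt
    · exact fun x hx => hx.2.differentiableWithinAt
  have h1 := (Complex.differentiableOn_dslope hs).2 hsf
  have h2 := (Complex.differentiableOn_dslope hs).2 hsg
  have hloc : LocallyDivides (dslope g ζ) (dslope f ζ) ζ := by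
    obtain ⟨t, hts, hto, hζt⟩ := _root_.mem_nhds_iff.1 hs
    exact locallyDivides_of_ne_zero (hto.mem_nhds hζt)
      (fun y hy => (h1.mono hts).differentiableAt (hto.mem_nhds hy))
      (fun y hy => (h2.mono hts).differentiableAt (hto.mem_nhds hy)) (by rwa [dslope_same])
  refine hloc.congr ⟨fun z => z - ζ, Eventually.of_forall fun z => ?_⟩
  have e1 := sub_smul_dslope g ζ z
  have e2 := sub_smul_dslope f ζ z
  rw [hg0, sub_zero] at e1
  rw [hf0, sub_zero] at e2
  exact ⟨e1.symm, e2.symm⟩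

/-- If `w` is not identically zero on the line through `p` in the direction `e`, it has no zero on
arbitrarily small circles about `p` in this line. -/
theorem exists_circle_ne_zero {W : Set E} (hW : IsOpen W) {w : E → ℂ}
    (hw : DifferentiableOn ℂ w W) {p e : E} (hp : p ∈ W) {n : ℕ}
    (hn : (dirDeriv e)^[n] w p ≠ 0) {ε : ℝ} (hε : 0 < ε) :
    ∃ r, 0 < r ∧ r < ε ∧ ∀ ζ ∈ sphere (0 : ℂ) r, w (p + ζ • e) ≠ 0 := by
  have han : AnalyticAt ℂ (fun ζ : ℂ => w (p + ζ • e)) 0 := analyticAt_line hW hw (by simpa using hp)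
  rcases han.eventually_eq_zero_or_eventually_ne_zero with h | h
  · rw [iterate_dirDeriv] at hn
    have h' : (fun ζ : ℂ => w (p + ζ • e)) =ᶠ[𝓝 0] fun _ => 0 := h
    refine absurd ?_ hn
    rw [h'.iteratedDeriv_eq]
    simp
  · rw [eventually_nhdsWithin_iff] at h
    obtain ⟨ρ, hρ, hb⟩ := Metric.eventually_nhds_iff.1 h
    refine ⟨min (ρ / 2) (ε / 2), by positivity, by
      have := min_le_right (ρ / 2) (ε / 2); linarith, fun ζ hζ => ?_⟩
    have hζ' : ‖ζ‖ = min (ρ / 2) (ε / 2) := by simpa using hζ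
    refine hb ?_ ?_
    · rw [dist_zero_right, hζ']; have := min_le_left (ρ / 2) (ε / 2); linarith
    · rintro rfl
      rw [norm_zero] at hζ'
      have : 0 < min (ρ / 2) (ε / 2) := by positivity
      linarith

variable [FiniteDimensional ℂ E]

/-- If `u / v` extends holomorphically to the discs of a dense set of parallel complex lines near
`p`, and `v` does not vanish on the boundary of the disc centred at `p`, then `u / v` extends
holomorphically near `p`. -/
theorem locallyDivides_of_dense_lines {u v : E → ℂ} {W : Set E} (hW : IsOpen W)
    (hu : DifferentiableOn ℂ u W) (hv : DifferentiableOn ℂ v W) {p e : E} {r : ℝ} (hr : 0 < r)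
    (hcyl : ∀ ζ ∈ closedBall (0 : ℂ) r, p + ζ • e ∈ W)
    (hne : ∀ ζ ∈ sphere (0 : ℂ) r, v (p + ζ • e) ≠ 0)
    (hdense : ∀ᶠ y in 𝓝 p, y ∈ closure {y | ∀ ζ ∈ closedBall (0 : ℂ) r,
      LocallyDivides (fun s : ℂ => v (y + s • e)) (fun s : ℂ => u (y + s • e)) ζ}) :
    LocallyDivides v u p := by
  set D : Set E := {y | ∀ ζ ∈ closedBall (0 : ℂ) r,
      LocallyDivides (fun s : ℂ => v (y + s • e)) (fun s : ℂ => u (y + s • e)) ζ} with hD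
  set V : Set E := {x | x ∈ W ∧ v x ≠ 0} with hVdef
  have hV : IsOpen V := hv.continuousOn.isOpen_inter_preimage hW isOpen_compl_singleton
  have hqd : DifferentiableOn ℂ (fun x => u x * (v x)⁻¹) V :=
    (hu.mono fun x hx => hx.1).mul ((hv.mono fun x hx => hx.1).fun_inv fun x hx => hx.2)
  have hpV : ∀ ζ ∈ sphere (0 : ℂ) r, p + ζ • e ∈ V := fun ζ hζ =>
    ⟨hcyl ζ (sphere_subset_closedBall hζ), hne ζ hζ⟩
  have hevV := eventually_forall_line_mem hV (isCompact_sphere (0 : ℂ) r) hpV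
  have hevW := eventually_forall_line_mem hW (isCompact_closedBall (0 : ℂ) r) hcyl
  -- The candidate quotient is the Cauchy integral of `u / v`, holomorphic in `y` because `v ≠ 0` on
  -- the circles. On a good line it equals the extended quotient at the centre, and density gives `u
  -- = F v` near `p`.
  set F : E → ℂ := fun y => (2 * Real.pi * Complex.I)⁻¹ *
    ∮ ζ in C(0, r), (ζ - 0)⁻¹ * (u (y + ζ • e) * (v (y + ζ • e))⁻¹) with hF
  have hFd : ∀ᶠ y in 𝓝 p, DifferentiableAt ℂ F y := by
    filter_upwards [hevV] with y hy
    refine (differentiableAt_circleIntegral_line hV hqd (c := fun ζ => (ζ - 0)⁻¹) hr.le ?_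
      hy).const_mul _
    refine ContinuousOn.inv₀ (by fun_prop) fun ζ hζ => ?_
    have : ζ ≠ 0 := by rintro rfl; simp at hζ; linarith
    simpa using this
  have hFD : ∀ᶠ y in 𝓝 p, y ∈ D → u y = F y * v y := by
    filter_upwards [hevV, hevW] with y hyV hyW hyD
    obtain ⟨Q, hQ⟩ := exists_glued_quotient (fun s : ℂ => v (y + s • e))
      (fun s : ℂ => u (y + s • e))
    have hrs : (r : ℂ) ∈ sphere (0 : ℂ) r := by simp [abs_of_pos hr]
    have han : AnalyticOnNhd ℂ (fun s : ℂ => v (y + s • e)) (closedBall 0 r) := fun ζ hζ =>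
      analyticAt_line hW hv (hyW ζ hζ)
    have hQ' : ∀ ζ ∈ closedBall (0 : ℂ) r,
        DifferentiableAt ℂ Q ζ ∧ u (y + ζ • e) = Q ζ * v (y + ζ • e) := fun ζ hζ =>
      hQ ζ (hyD ζ hζ) (eventually_frequently_ne_zero han (sphere_subset_closedBall hrs)
        (hyV _ hrs).2 hζ)
    have hcauchy :=
      Complex.two_pi_I_inv_smul_circleIntegral_sub_inv_smul_of_differentiable_on_off_countable
      (s := ∅) (w := 0) (c := 0) (R := r) (f := Q) countable_empty (mem_ball_self hr)
      (fun ζ hζ => (hQ' ζ hζ).1.continuousAt.continuousWithinAt)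
      (fun ζ hζ => (hQ' ζ (ball_subset_closedBall hζ.1)).1)
    have hint : ∮ ζ in C(0, r), (ζ - 0)⁻¹ * (u (y + ζ • e) * (v (y + ζ • e))⁻¹) =
        ∮ ζ in C(0, r), (ζ - 0)⁻¹ • Q ζ :=
      circleIntegral.integral_congr hr.le fun ζ hζ => by
        simp only [smul_eq_mul]
        rw [(hQ' ζ (sphere_subset_closedBall hζ)).2, mul_inv_cancel_right₀ (hyV ζ hζ).2]
    have hFQ : F y = Q 0 := by
      simp only [hF]
      rw [hint, ← smul_eq_mul, hcauchy]
    have := (hQ' 0 (mem_closedBall_self hr.le)).2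
    rw [zero_smul, add_zero] at this
    rw [hFQ, this]
  have hpW : ∀ᶠ y in 𝓝 p, y ∈ W := hW.mem_nhds (by simpa using hcyl 0 (mem_closedBall_self hr.le))
  refine ⟨F, ?_⟩
  filter_upwards [hFd, hdense, hFD.eventually_nhds, hpW] with y hyF hyD hyFD hyW
  refine ⟨hyF, ?_⟩
  by_contra hcon
  have hc1 := ((hu y hyW).differentiableAt (hW.mem_nhds hyW)).continuousAt
  have hc2 := ((hv y hyW).differentiableAt (hW.mem_nhds hyW)).continuousAt
  have hev := (hc1.sub (hyF.continuousAt.mul hc2)).eventually_ne (sub_ne_zero.2 hcon)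
  obtain ⟨z, hzD, hz1, hz2⟩ := ((mem_closure_iff_frequently.1 hyD).and_eventually
    (hyFD.and hev)).exists
  exact hz2 (sub_eq_zero.2 (hz1 hzD))

/-- Near a point where `w` has nonzero derivative, a function vanishing on `{w = 0}` is a multiple
of `w`. -/
theorem locallyDivides_of_dirDeriv_ne_zero {W : Set E} (hW : IsOpen W) {w f : E → ℂ}
    (hw : DifferentiableOn ℂ w W) (hf : DifferentiableOn ℂ f W)
    (h0 : ∀ x ∈ W, w x = 0 → f x = 0) {p e : E} (hp : p ∈ W) (hd : dirDeriv e w p ≠ 0) :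
    LocallyDivides w f p := by
  set V : Set E := {x | x ∈ W ∧ dirDeriv e w x ≠ 0} with hVdef
  have hV : IsOpen V :=
    (hw.dirDeriv hW e).continuousOn.isOpen_inter_preimage hW isOpen_compl_singleton
  have hlc : Continuous fun ζ : ℂ => p + ζ • e := by fun_prop
  obtain ⟨ε, hε, hεV⟩ := Metric.nhds_basis_ball.mem_iff.1
    ((hV.preimage hlc).mem_nhds (show p + (0 : ℂ) • e ∈ V by rw [zero_smul, add_zero]; exact ⟨hp, hd⟩))
  obtain ⟨r, hr, hrε, hne⟩ := exists_circle_ne_zero hW hw (n := 1) hp (by simpa using hd) hε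
  have hcyl : ∀ ζ ∈ closedBall (0 : ℂ) r, p + ζ • e ∈ V := fun ζ hζ =>
    hεV (closedBall_subset_ball hrε hζ)
  -- Here every nearby line is good: `w` has only simple zeros on it, and `f` vanishes at them.
  refine locallyDivides_of_dense_lines hW hf hw hr (fun ζ hζ => (hcyl ζ hζ).1) hne ?_
  filter_upwards [eventually_forall_line_mem hV (isCompact_closedBall (0 : ℂ) r) hcyl] with y hy
  refine subset_closure fun ζ hζ => ?_
  have hyW := (hy ζ hζ).1
  have haw := analyticAt_line hW hw hyW
  have haf := analyticAt_line hW hf hyW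
  by_cases hz : w (y + ζ • e) = 0
  · refine locallyDivides_of_deriv_ne_zero haf haw (h0 _ hyW hz) hz ?_
    rw [← dirDeriv_line]; exact (hy ζ hζ).2
  · exact locallyDivides_of_ne_zero (Filter.inter_mem haf.eventually_analyticAt
      haw.eventually_analyticAt) (fun s hs => hs.1.differentiableAt)
      (fun s hs => hs.2.differentiableAt) hz

end LocalQuotient

/-! ### A fraction without poles is holomorphic. -/

section Extension

open Metric Set Filter Topology

variable {E : Type*} [NormedAddCommGroup E] [NormedSpace ℂ E]

/-- The fraction `u / v` does not take the value `∞` on `W`, however one reduces it. -/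
def IsPoleFree (u v : E → ℂ) (W : Set E) : Prop :=
  ∀ W' ⊆ W, IsOpen W' → ∀ k u' v' : E → ℂ, DifferentiableOn ℂ u' W' → DifferentiableOn ℂ v' W' →
    (∀ x ∈ W', u x = k x * u' x ∧ v x = k x * v' x) → ∀ x ∈ W', v' x = 0 → u' x = 0

theorem IsPoleFree.eq_zero {u v : E → ℂ} {W : Set E} (h : IsPoleFree u v W) (hW : IsOpen W)
    (hu : DifferentiableOn ℂ u W) (hv : DifferentiableOn ℂ v W) {x : E} (hx : x ∈ W)
    (h0 : v x = 0) : u x = 0 :=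
  h W subset_rfl hW (fun _ => 1) u v hu hv (by simp) x hx h0

theorem IsPoleFree.of_mul_eq {u v u₁ v₁ w : E → ℂ} {W W₁ : Set E} (h : IsPoleFree u v W)
    (hW₁ : W₁ ⊆ W) (hm : ∀ x ∈ W₁, u x = w x * u₁ x ∧ v x = w x * v₁ x) :
    IsPoleFree u₁ v₁ W₁ := by
  intro W' hW' ho k u' v' hu' hv' hk
  refine h W' (hW'.trans hW₁) ho (fun x => w x * k x) u' v' hu' hv' fun x hx => ?_
  rw [(hm x (hW' hx)).1, (hm x (hW' hx)).2, (hk x hx).1, (hk x hx).2]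
  constructor <;> ring

/-- If `v = w v₁` and `w` vanishes at `z`, then the order of `v₁` at `z` is less than that of
`v`. -/
theorem exists_iterate_dirDeriv_ne_zero_of_mul {W : Set E} (hW : IsOpen W) {w v v₁ : E → ℂ}
    (hw : DifferentiableOn ℂ w W) (hv₁ : DifferentiableOn ℂ v₁ W)
    (h : ∀ x ∈ W, v x = w x * v₁ x) {z e : E} (hz : z ∈ W) (hz0 : w z = 0) {m : ℕ}
    (hm : (dirDeriv e)^[m + 1] v z ≠ 0) : ∃ k ≤ m, (dirDeriv e)^[k] v₁ z ≠ 0 := by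
  by_contra! hcon
  apply hm
  have hzW : z + (0 : ℂ) • e ∈ W := by simpa using hz
  have aw := analyticAt_line hW hw hzW
  have av := analyticAt_line hW hv₁ hzW
  have hev : (fun s : ℂ => v (z + s • e)) =ᶠ[𝓝 0]
      (fun s : ℂ => w (z + s • e)) * fun s : ℂ => v₁ (z + s • e) := by
    filter_upwards [(hasDerivAt_line z e 0).continuousAt.eventually (hW.mem_nhds hzW)] with s hs
    exact h _ hs
  have o1 : (1 : ℕ∞) ≤ analyticOrderAt (fun s : ℂ => w (z + s • e)) 0 := by
    rw [Order.one_le_iff_ne_zero, aw.analyticOrderAt_ne_zero]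
    simpa using hz0
  have o2 : ((m + 1 : ℕ) : ℕ∞) ≤ analyticOrderAt (fun s : ℂ => v₁ (z + s • e)) 0 := by
    rw [natCast_le_analyticOrderAt_iff_iteratedDeriv_eq_zero av]
    intro i hi
    rw [← iterate_dirDeriv]
    exact hcon i (by omega)
  have o3 : ((m + 2 : ℕ) : ℕ∞) ≤ analyticOrderAt (fun s : ℂ => v (z + s • e)) 0 := by
    rw [analyticOrderAt_congr hev, analyticOrderAt_mul aw av]
    calc ((m + 2 : ℕ) : ℕ∞) = 1 + ((m + 1 : ℕ) : ℕ∞) := by push_cast; ring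
      _ ≤ _ := add_le_add o1 o2
  rw [natCast_le_analyticOrderAt_iff_iteratedDeriv_eq_zero ((aw.mul av).congr hev.symm)] at o3
  rw [iterate_dirDeriv]
  exact o3 (m + 1) (by omega)

/-- A holomorphic function of one variable with nearly constant nonzero derivative on a disc is
injective there. -/
theorem eq_of_norm_deriv_sub_le {f : ℂ → ℂ} {r : ℝ} {c : ℂ} (hc : c ≠ 0)
    (hf : ∀ ζ ∈ closedBall (0 : ℂ) r, DifferentiableAt ℂ f ζ)
    (hd : ∀ ζ ∈ closedBall (0 : ℂ) r, ‖deriv f ζ - c‖ ≤ ‖c‖ / 2) {x y : ℂ}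
    (hx : x ∈ closedBall (0 : ℂ) r) (hy : y ∈ closedBall (0 : ℂ) r) (h : f x = f y) : x = y := by
  have := Convex.norm_image_sub_le_of_norm_hasDerivWithin_le (f := fun ζ => f ζ - c * ζ)
    (f' := fun ζ => deriv f ζ - c) (C := ‖c‖ / 2) (fun ζ hζ => by
      have h1 := (hf ζ hζ).hasDerivAt.fun_sub ((hasDerivAt_id' ζ).const_mul c)
      rw [mul_one] at h1
      exact h1.hasDerivWithinAt) hd (convex_closedBall (0 : ℂ) r) hx hy
  rw [h, show f y - c * y - (f y - c * x) = -(c * (y - x)) by ring, norm_neg, norm_mul] at this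
  have hc' := norm_pos_iff.2 hc
  have h0 : ‖y - x‖ = 0 := by
    have := norm_nonneg (y - x)
    nlinarith
  exact (sub_eq_zero.1 (norm_eq_zero.1 h0)).symm

variable [FiniteDimensional ℂ E]

/-- Strong induction on `n`. For `n = m + 1` put `w = ∂ₑᵐ v`, so that `∂ₑ w ≠ 0` near `p`. Off `{w =
0}` the case `m` applies; on this smooth hypersurface the order is lowered by cancelling `w`. -/
theorem IsPoleFree.locallyDivides_of_iterate_dirDeriv_ne_zero (e : E) (n : ℕ) :
    ∀ {u v : E → ℂ} {W : Set E} {p : E}, IsOpen W → DifferentiableOn ℂ u W →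
      DifferentiableOn ℂ v W → IsPoleFree u v W → p ∈ W → (dirDeriv e)^[n] v p ≠ 0 →
      LocallyDivides v u p := by
  induction n using Nat.strong_induction_on with
  | _ n ih =>
  intro u v W p hW hu hv hpf hp hn
  have hquot : ∀ x ∈ W, v x ≠ 0 → LocallyDivides v u x := fun x hx h0 =>
    locallyDivides_of_ne_zero (hW.mem_nhds hx) (fun y hy => hu.differentiableAt (hW.mem_nhds hy))
      (fun y hy => hv.differentiableAt (hW.mem_nhds hy)) h0
  rcases n with _ | m
  · exact hquot p hp hn
  set w := (dirDeriv e)^[m] v with hw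
  have hwd : DifferentiableOn ℂ w W := hv.iterate_dirDeriv hW e m
  have hgood : ∀ x ∈ W, w x ≠ 0 → LocallyDivides v u x := fun x hx h0 =>
    ih m (Nat.lt_succ_self m) hW hu hv hpf hx h0
  set g := dirDeriv e w with hg
  have hgn : (dirDeriv e)^[m + 1] v = g := Function.iterate_succ_apply' _ _ _
  rw [hgn] at hn
  have hgc : ContinuousOn g W := (hwd.dirDeriv hW e).continuousOn
  set c := g p with hcdef
  have hc2 : 0 < ‖c‖ / 2 := by have := norm_pos_iff.2 hn; linarith
  -- a neighbourhood of `p` on which `g` is nearly constant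
  set N : Set E := {x | x ∈ W ∧ g x ∈ ball c (‖c‖ / 2)} with hNdef
  have hN : IsOpen N := hgc.isOpen_inter_preimage hW isOpen_ball
  have hNW : N ⊆ W := fun x hx => hx.1
  have hgN : ∀ x ∈ N, ‖g x - c‖ ≤ ‖c‖ / 2 := fun x hx => by
    rw [← dist_eq_norm]; exact le_of_lt hx.2
  have hg0 : ∀ x ∈ N, g x ≠ 0 := fun x hx h => by
    have := hgN x hx
    rw [h, zero_sub, norm_neg] at this
    linarith
  have hlc : Continuous fun ζ : ℂ => p + ζ • e := by fun_prop
  obtain ⟨ε, hε, hεN⟩ := Metric.nhds_basis_ball.mem_iff.1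
    ((hN.preimage hlc).mem_nhds (show p + (0 : ℂ) • e ∈ N by
      rw [zero_smul, add_zero]; exact ⟨hp, mem_ball_self hc2⟩))
  obtain ⟨r, hr, hrε, hne⟩ := exists_circle_ne_zero hW hv (n := m + 1) hp (by rw [hgn]; exact hn) hε
  have hcyl : ∀ ζ ∈ closedBall (0 : ℂ) r, p + ζ • e ∈ N := fun ζ hζ =>
    hεN (closedBall_subset_ball hrε hζ)
  -- points at which `u / v` extends are dense in `{w = 0}`
  have hclaim : ∀ z ∈ N, w z = 0 → ∀ O ∈ 𝓝 z, ∃ z' ∈ O, z' ∈ N ∧ w z' = 0 ∧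
      LocallyDivides v u z' := by
    intro z hz hz0 O hO
    -- Otherwise `v`, hence `u`, vanishes on `{w = 0}` near `z`, as `u / v` extends wherever `v ≠
    -- 0`. Then `w` divides both, the order of `v / w` at `z` is at most `m`, and induction extends
    -- `u / v` at `z` after all.
    by_contra! hcon
    obtain ⟨O', hO'sub, hO', hzO'⟩ := _root_.mem_nhds_iff.1 (Filter.inter_mem hO (hN.mem_nhds hz))
    have hO'W : O' ⊆ W := fun x hx => (hO'sub hx).2.1
    have hv0 : ∀ x ∈ O', w x = 0 → v x = 0 := fun x hx hx0 => by
      by_contra hvx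
      exact hcon x (hO'sub hx).1 (hO'sub hx).2 hx0 (hquot x (hO'W hx) hvx)
    have hu0 : ∀ x ∈ O', w x = 0 → u x = 0 := fun x hx hx0 =>
      hpf.eq_zero hW hu hv (hO'W hx) (hv0 x hx hx0)
    obtain ⟨v₁, hv₁⟩ := locallyDivides_of_dirDeriv_ne_zero hO' (hwd.mono hO'W) (hv.mono hO'W) hv0
      hzO' (hg0 z hz)
    obtain ⟨u₁, hu₁⟩ := locallyDivides_of_dirDeriv_ne_zero hO' (hwd.mono hO'W) (hu.mono hO'W) hu0
      hzO' (hg0 z hz)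
    obtain ⟨W₁, hW₁, hW₁o, hzW₁⟩ := _root_.mem_nhds_iff.1
      (Filter.inter_mem (hv₁.and hu₁) (hO'.mem_nhds hzO'))
    have hW₁W : W₁ ⊆ W := fun x hx => hO'W (hW₁ hx).2
    have hu₁d : DifferentiableOn ℂ u₁ W₁ := fun x hx => (hW₁ hx).1.2.1.differentiableWithinAt
    have hv₁d : DifferentiableOn ℂ v₁ W₁ := fun x hx => (hW₁ hx).1.1.1.differentiableWithinAt
    have hmul : ∀ x ∈ W₁, u x = w x * u₁ x ∧ v x = w x * v₁ x := fun x hx =>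
      ⟨by rw [(hW₁ hx).1.2.2, mul_comm], by rw [(hW₁ hx).1.1.2, mul_comm]⟩
    obtain ⟨k, hk, hk0⟩ := exists_iterate_dirDeriv_ne_zero_of_mul hW₁o (hwd.mono hW₁W) hv₁d
      (fun x hx => (hmul x hx).2) hzW₁ hz0 (hgn ▸ hg0 z hz : (dirDeriv e)^[m + 1] v z ≠ 0)
    have hdiv := ih k (Nat.lt_succ_of_le hk) hW₁o hu₁d hv₁d (hpf.of_mul_eq hW₁W hmul) hzW₁ hk0
    refine hcon z (mem_of_mem_nhds hO) hz hz0 (hdiv.congr ⟨w, ?_⟩)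
    filter_upwards [hW₁o.mem_nhds hzW₁] with x hx
    exact ⟨(hmul x hx).2, (hmul x hx).1⟩
  refine locallyDivides_of_dense_lines hW hu hv hr (fun ζ hζ => hNW (hcyl ζ hζ)) hne ?_
  have hcylev := eventually_forall_line_mem hN (isCompact_closedBall (0 : ℂ) r) hcyl
  filter_upwards [hcylev.eventually_nhds] with y hy
  rw [_root_.mem_closure_iff_nhds]
  intro O hO
  obtain ⟨O', hO'sub, hO', hyO'⟩ := _root_.mem_nhds_iff.1 (Filter.inter_mem hO hy)
  -- A disc near `p` meets `{w = 0}` at most once, since `∂ₑ w` is nearly constant. A small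
  -- translation moves that meeting point to a point where `u / v` extends.
  by_cases hz : ∃ ζ₀ ∈ closedBall (0 : ℂ) r, w (y + ζ₀ • e) = 0
  · obtain ⟨ζ₀, hζ₀, hz0⟩ := hz
    have hcont : ContinuousAt (fun x : E => x - ζ₀ • e) (y + ζ₀ • e) := by fun_prop
    obtain ⟨z', hz'O, hz'N, hz'0, hz'⟩ := hclaim _ (hy.self_of_nhds ζ₀ hζ₀) hz0 _
      (hcont.preimage_mem_nhds (by rw [add_sub_cancel_right]; exact hO'.mem_nhds hyO'))
    refine ⟨z' - ζ₀ • e, (hO'sub hz'O).1, fun ζ hζ => LocallyDivides.line ?_⟩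
    have hN' := (hO'sub hz'O).2
    by_cases hw0 : w (z' - ζ₀ • e + ζ • e) = 0
    · have hζζ : ζ = ζ₀ := by
        refine eq_of_norm_deriv_sub_le (f := fun s : ℂ => w (z' - ζ₀ • e + s • e)) (c := c) hn
          (fun s hs => (hwd.differentiableAt (hW.mem_nhds (hNW (hN' s hs)))).comp_line)
          (fun s hs => by rw [← dirDeriv_line]; exact hgN _ (hN' s hs)) hζ hζ₀ ?_
        simp only [hw0, sub_add_cancel, hz'0]
      rwa [hζζ, sub_add_cancel]
    · exact hgood _ (hNW (hN' ζ hζ)) hw0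
  · push Not at hz
    exact ⟨y, mem_of_mem_nhds hO, fun ζ hζ => LocallyDivides.line
      (hgood _ (hNW (hy.self_of_nhds ζ hζ)) (hz ζ hζ))⟩

/-- A fraction of holomorphic functions of several variables which does not take the value `∞` is
a holomorphic function; in particular it has no points of indeterminacy. -/
theorem IsPoleFree.locallyDivides {u v : E → ℂ} {W : Set E} (h : IsPoleFree u v W)
    (hW : IsOpen W) (hu : DifferentiableOn ℂ u W) (hv : DifferentiableOn ℂ v W)
    (hd : W ⊆ closure {x | v x ≠ 0}) {p : E} (hp : p ∈ W) : LocallyDivides v u p := by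
  obtain ⟨ρ, hρ, hρW⟩ := Metric.isOpen_iff.1 hW p hp
  obtain ⟨y, hy0, hy⟩ := Metric.mem_closure_iff.1 (hd hp) ρ hρ
  -- The line from `p` towards a nonzero of `v` is a direction in which `v` has finite order at `p`.
  set e := y - p with he
  have hen : ‖e‖ < ρ := by rwa [dist_comm, dist_eq_norm] at hy
  have hmem : ∀ ζ ∈ closedBall (0 : ℂ) 1, p + ζ • e ∈ W := by
    intro ζ hζ
    apply hρW
    rw [mem_ball, dist_self_add_left, norm_smul]
    have h1 : ‖ζ‖ ≤ 1 := by simpa using hζ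
    nlinarith [norm_nonneg e]
  have han : AnalyticOnNhd ℂ (fun s : ℂ => v (p + s • e)) (closedBall 0 1) := fun ζ hζ =>
    analyticAt_line hW hv (hmem ζ hζ)
  have h0 : (0 : ℂ) ∈ closedBall (0 : ℂ) 1 := by simp
  have hfreq := (eventually_frequently_ne_zero han (ζ₀ := 1) (by simp) (by simpa [he] using hy0)
    h0).self_of_nhds.2
  have htop : analyticOrderAt (fun s : ℂ => v (p + s • e)) 0 ≠ ⊤ := fun htop =>
    hfreq (by simpa using analyticOrderAt_eq_top.1 htop)
  obtain ⟨n, hn⟩ := ENat.ne_top_iff_exists.1 htop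
  refine h.locallyDivides_of_iterate_dirDeriv_ne_zero e n hW hu hv hp ?_
  rw [iterate_dirDeriv]
  exact ((analyticOrderAt_eq_nat_iff_iteratedDeriv_eq_zero (han 0 h0)).1 hn.symm).2

end Extension

/-! ### Holomorphic functions on a Lie group omitting `0` and `1`. -/

section LieGroup

open Metric Set Filter Topology

variable {E : Type*} [NormedAddCommGroup E] [NormedSpace ℂ E]
  {G : Type*} [Group G] [TopologicalSpace G] [ChartedSpace E G] [LieGroup 𝓘(ℂ, E) ω G]

theorem ContMDiffAt.npow {E' : Type*} [NormedAddCommGroup E'] [NormedSpace ℂ E'] {c : E' → G}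
    {z : E'} (hc : ContMDiffAt 𝓘(ℂ, E') 𝓘(ℂ, E) ω c z) (n : ℕ) :
    ContMDiffAt 𝓘(ℂ, E') 𝓘(ℂ, E) ω (fun z => c z ^ n) z := by
  induction n with
  | zero => simpa using contMDiffAt_const
  | succ n ih => exact (ih.mul hc).congr_of_eventuallyEq (Eventually.of_forall fun z => pow_succ _ _)

theorem MDifferentiable.differentiableAt_comp_mul {E' : Type*} [NormedAddCommGroup E']
    [NormedSpace ℂ E'] {F : G → ℂ} (hF : MDifferentiable 𝓘(ℂ, E) 𝓘(ℂ, ℂ) F) {a b : E' → G} {z : E'}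
    (ha : ContMDiffAt 𝓘(ℂ, E') 𝓘(ℂ, E) ω a z) (hb : ContMDiffAt 𝓘(ℂ, E') 𝓘(ℂ, E) ω b z) :
    DifferentiableAt ℂ (fun z => F (a z * b z)) z := by
  have h1 : MDifferentiableAt 𝓘(ℂ, E') 𝓘(ℂ, E) (fun z => a z * b z) z :=
    (ha.mul hb).mdifferentiableAt (by simp)
  exact mdifferentiableAt_iff_differentiableAt.1
    (MDifferentiableAt.comp (I' := 𝓘(ℂ, E)) z (hF (a z * b z)) h1)

/-- Along the `n`-th power of a curve through `1`, a function has `n` times the derivative that it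
has along the curve. -/
theorem hasDerivAt_comp_mul_pow {F : G → ℂ} (hF : MDifferentiable 𝓘(ℂ, E) 𝓘(ℂ, ℂ) F) {c : ℂ → G}
    (hc : ContMDiffAt 𝓘(ℂ, ℂ) 𝓘(ℂ, E) ω c 0) (hc0 : c 0 = 1) (x : G) (n : ℕ) :
    HasDerivAt (fun z => F (x * c z ^ n)) (n * deriv (fun z => F (x * c z)) 0) 0 := by
  induction n with
  | zero => simpa using hasDerivAt_const (0 : ℂ) (F x)
  | succ n ih =>
    have h1 : ContMDiffAt 𝓘(ℂ, ℂ × ℂ) 𝓘(ℂ, E) ω (fun p : ℂ × ℂ => c p.1) (0, 0) :=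
      ContMDiffAt.comp (I' := 𝓘(ℂ, ℂ)) (0, 0) (g := c) (f := Prod.fst) hc
        contDiffAt_fst.contMDiffAt
    have h2 : ContMDiffAt 𝓘(ℂ, ℂ × ℂ) 𝓘(ℂ, E) ω (fun p : ℂ × ℂ => c p.2) (0, 0) :=
      ContMDiffAt.comp (I' := 𝓘(ℂ, ℂ)) (0, 0) (g := c) (f := Prod.snd) hc
        contDiffAt_snd.contMDiffAt
    -- The last factor gets its own variable; the derivative along the diagonal is the sum of the
    -- two partial ones, and `c 0 = 1` identifies them.
    have hk : DifferentiableAt ℂ (fun p : ℂ × ℂ => F ((x * c p.1 ^ n) * c p.2)) (0, 0) :=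
      hF.differentiableAt_comp_mul ((contMDiffAt_const (c := x)).mul (h1.npow n)) h2
    obtain ⟨L, hk⟩ := hk
    have hd : HasDerivAt (fun z : ℂ => (z, z)) ((1, 1) : ℂ × ℂ) 0 :=
      (hasDerivAt_id' 0).prodMk (hasDerivAt_id' 0)
    have hd1 : HasDerivAt (fun z : ℂ => (z, (0 : ℂ))) ((1, 0) : ℂ × ℂ) 0 :=
      (hasDerivAt_id' 0).prodMk (hasDerivAt_const 0 0)
    have hd2 : HasDerivAt (fun z : ℂ => ((0 : ℂ), z)) ((0, 1) : ℂ × ℂ) 0 :=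
      (hasDerivAt_const 0 0).prodMk (hasDerivAt_id' 0)
    have e := HasFDerivAt.comp_hasDerivAt (0 : ℂ) (f := fun z : ℂ => (z, z)) hk hd
    have e1 := HasFDerivAt.comp_hasDerivAt (0 : ℂ) (f := fun z : ℂ => (z, (0 : ℂ))) hk hd1
    have e2 := HasFDerivAt.comp_hasDerivAt (0 : ℂ) (f := fun z : ℂ => ((0 : ℂ), z)) hk hd2
    have l1 : L (1, 0) = n * deriv (fun z => F (x * c z)) 0 := by
      refine e1.unique ?_
      simpa [Function.comp_def, hc0] using ih
    have l2 : L (0, 1) = deriv (fun z => F (x * c z)) 0 := by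
      rw [← e2.deriv]
      simp [Function.comp_def, hc0]
    have l3 : L (1, 1) = L (1, 0) + L (0, 1) := by rw [← map_add]; simp
    rw [l3, l1, l2] at e
    have : ((n + 1 : ℕ) : ℂ) * deriv (fun z => F (x * c z)) 0 =
        n * deriv (fun z => F (x * c z)) 0 + deriv (fun z => F (x * c z)) 0 := by
      push_cast; ring
    rw [this]
    refine e.congr_of_eventuallyEq (Eventually.of_forall fun z => ?_)
    simp [pow_succ, mul_assoc]

/-- Powers of a holomorphic disc through `1` give arbitrarily large discs with the same
derivative, so Landau's theorem applies. -/
theorem deriv_comp_mul_eq_zero_of_omits {F : G → ℂ} (hF : MDifferentiable 𝓘(ℂ, E) 𝓘(ℂ, ℂ) F)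
    (h01 : ∀ x, F x ≠ 0 ∧ F x ≠ 1) {c : ℂ → G} {r : ℝ} (hr : 0 < r)
    (hc : ∀ z ∈ ball (0 : ℂ) r, ContMDiffAt 𝓘(ℂ, ℂ) 𝓘(ℂ, E) ω c z) (hc0 : c 0 = 1) (x : G) :
    deriv (fun z => F (x * c z)) 0 = 0 := by
  obtain ⟨C, hC⟩ := exists_norm_deriv_mul_le_of_omits (F x)
  set d := deriv (fun z => F (x * c z)) 0 with hd
  have key : ∀ n : ℕ, ‖d‖ * ((n + 1) * r) ≤ C := by
    intro n
    have hn0 : ((n + 1 : ℕ) : ℂ) ≠ 0 := Nat.cast_ne_zero.2 n.succ_ne_zero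
    have hscale : HasDerivAt (fun z : ℂ => z / ((n + 1 : ℕ) : ℂ)) (1 / ((n + 1 : ℕ) : ℂ)) 0 :=
      (hasDerivAt_id' 0).div_const _
    have hder : HasDerivAt (fun z : ℂ => F (x * c (z / ((n + 1 : ℕ) : ℂ)) ^ (n + 1))) d 0 := by
      have h1 := hasDerivAt_comp_mul_pow hF (hc 0 (mem_ball_self hr)) hc0 x (n + 1)
      have h2 := HasDerivAt.comp (0 : ℂ) (h₂ := fun z => F (x * c z ^ (n + 1)))
        (h := fun z : ℂ => z / ((n + 1 : ℕ) : ℂ)) (by rwa [zero_div]) hscale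
      refine h2.congr_deriv ?_
      rw [mul_one_div, mul_div_cancel_left₀ _ hn0]
    have h3 := hC ((n + 1) * r) (fun z : ℂ => F (x * c (z / ((n + 1 : ℕ) : ℂ)) ^ (n + 1)))
      (by positivity) (by
        intro z hz
        have hz' : z / ((n + 1 : ℕ) : ℂ) ∈ ball (0 : ℂ) r := by
          rw [mem_ball_zero_iff] at hz ⊢
          rw [norm_div, Complex.norm_natCast, div_lt_iff₀ (by positivity)]
          push_cast; linarith
        have hg : DifferentiableAt ℂ (fun z => F (x * c z ^ (n + 1))) (z / ((n + 1 : ℕ) : ℂ)) :=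
          hF.differentiableAt_comp_mul contMDiffAt_const ((hc _ hz').npow (n + 1))
        exact (hg.comp z (f := fun z : ℂ => z / ((n + 1 : ℕ) : ℂ))
          (by fun_prop)).differentiableWithinAt)
      (by simp [hc0]) (fun z _ => h01 _)
    rwa [hder.deriv] at h3
  by_contra hne
  have hpos : 0 < ‖d‖ * r := mul_pos (norm_pos_iff.2 hne) hr
  obtain ⟨n, hn⟩ := exists_nat_gt (C / (‖d‖ * r))
  rw [div_lt_iff₀ hpos] at hn
  have := key n
  nlinarith

/-- A holomorphic function on a connected complex Lie group omitting `0` and `1` is constant. -/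
theorem MDifferentiable.exists_eq_const_of_omits [ConnectedSpace G] {F : G → ℂ}
    (hF : MDifferentiable 𝓘(ℂ, E) 𝓘(ℂ, ℂ) F) (h01 : ∀ x, F x ≠ 0 ∧ F x ≠ 1) :
    ∃ c, ∀ x, F x = c := by
  suffices h : IsLocallyConstant F from
    ⟨F 1, fun x => h.apply_eq_of_preconnectedSpace x 1⟩
  rw [IsLocallyConstant.iff_eventually_eq]
  intro p
  set χ := chartAt E p with hχ
  have hsymm : ∀ y ∈ χ.target, ContMDiffAt 𝓘(ℂ, E) 𝓘(ℂ, E) ω χ.symm y := fun y hy =>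
    (contMDiffOn_chart_symm (I := 𝓘(ℂ, E)) (n := ω) (x := p)).contMDiffAt
      (χ.open_target.mem_nhds hy)
  have hd : ∀ y ∈ χ.target, DifferentiableAt ℂ (fun y => F (χ.symm y)) y := fun y hy => by
    simpa using hF.differentiableAt_comp_mul (contMDiffAt_const (c := 1)) (hsymm y hy)
  have hd0 : ∀ y ∈ χ.target, fderiv ℂ (fun y => F (χ.symm y)) y = 0 := by
    intro y hy
    ext v
    have hlc : Continuous fun z : ℂ => y + z • v := by fun_prop
    obtain ⟨r, hr, hrt⟩ := Metric.nhds_basis_ball.mem_iff.1 ((χ.open_target.preimage hlc).mem_nhds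
      (show y + (0 : ℂ) • v ∈ χ.target by rwa [zero_smul, add_zero]))
    -- A left translation carries the coordinate line in the direction `v` to a disc through `1`.
    have h1 := deriv_comp_mul_eq_zero_of_omits hF h01 hr
      (c := fun z : ℂ => (χ.symm y)⁻¹ * χ.symm (y + z • v)) (fun z hz => by
        refine contMDiffAt_const.mul (ContMDiffAt.comp (I' := 𝓘(ℂ, E)) z (g := χ.symm)
          (f := fun z : ℂ => y + z • v) (hsymm _ (hrt hz)) ?_)
        exact ContDiffAt.contMDiffAt (by fun_prop)) (by simp) (χ.symm y)
    simp only [mul_inv_cancel_left] at h1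
    have h2 := HasFDerivAt.comp_hasDerivAt (0 : ℂ) (f := fun z : ℂ => y + z • v)
      (l := fun y => F (χ.symm y)) (l' := fderiv ℂ (fun y => F (χ.symm y)) y)
      (by rw [zero_smul, add_zero]; exact (hd y hy).hasFDerivAt) (hasDerivAt_line y v 0)
    rw [← h2.deriv]
    exact h1
  have hp : χ p ∈ χ.target := mem_chart_target E p
  obtain ⟨ρ, hρ, hb⟩ := Metric.isOpen_iff.1 χ.open_target _ hp
  have hps : p ∈ χ.source := mem_chart_source E p
  let _ : NormedSpace ℝ E := NormedSpace.restrictScalars ℝ ℂ E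
  filter_upwards [χ.open_source.mem_nhds hps,
    (χ.continuousAt hps).preimage_mem_nhds (ball_mem_nhds _ hρ)] with x hx hxb
  have := isOpen_ball.is_const_of_fderiv_eq_zero (𝕜 := ℂ) (f := fun y => F (χ.symm y))
    (convex_ball (χ p) ρ).isPreconnected
    (fun y hy => (hd y (hb hy)).differentiableWithinAt) (fun y hy => hd0 y (hb hy)) hxb
    (mem_ball_self hρ)
  simpa [χ.left_inv hx, χ.left_inv hps] using this

end LieGroup

/-! ### Omitted values and linear forms in numerator and denominator. -/

section Meromorphic

open Metric Set Filter Topology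

/-- Coefficients of a linear form on `ℂ²` whose zeros are the homogeneous coordinates of `a`. -/
noncomputable def homogForm : OnePoint ℂ → ℂ × ℂ
  | none => (0, 1)
  | some a => (1, -a)

theorem homogForm_det_ne_zero {a b : OnePoint ℂ} (h : a ≠ b) :
    (homogForm a).1 * (homogForm b).2 - (homogForm a).2 * (homogForm b).1 ≠ 0 := by
  rcases a with _ | a <;> rcases b with _ | b
  · exact absurd rfl h
  · simp [homogForm]
  · simp [homogForm]
  · intro hab
    apply h
    simp only [homogForm] at hab
    congr 1
    linear_combination hab

variable {E : Type*} [NormedAddCommGroup E] [NormedSpace ℂ E]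
  {M : Type*} [TopologicalSpace M] [ChartedSpace E M]

namespace LocalFraction

/-- The linear form attached to `a`, evaluated at `(num, den)`. -/
noncomputable def form (φ : LocalFraction E M) (a : OnePoint ℂ) (x : M) : ℂ :=
  (homogForm a).1 * φ.num x + (homogForm a).2 * φ.den x

theorem value_eq_of_form_eq_zero {φ : LocalFraction E M} {a : OnePoint ℂ} {x : M}
    (hφ : φ.IsDeterminateAt x) (h : φ.form a x = 0) : φ.value x = a := by
  obtain ⟨-, h0⟩ := hφ
  unfold value
  rcases a with _ | a
  · simp only [form, homogForm, zero_mul, one_mul, zero_add] at h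
    rw [if_pos h]; rfl
  · simp only [form, homogForm, one_mul] at h
    have hd : φ.den x ≠ 0 := fun hd => by simp [hd] at h h0; exact h0 h
    rw [if_neg hd]
    have : φ.num x / φ.den x = a := by
      rw [div_eq_iff hd]; linear_combination h
    rw [this]; rfl

/-- This makes the Möbius transform `form a / form b` independent of the local fraction. -/
theorem Compatible.form_mul_form {φ ψ : LocalFraction E M} (h : φ.Compatible ψ) (a b : OnePoint ℂ)
    {x : M} (hx : x ∈ φ.source ∩ ψ.source) :
    φ.form a x * ψ.form b x = ψ.form a x * φ.form b x := by
  have := h x hx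
  simp only [form]
  linear_combination ((homogForm a).1 * (homogForm b).2 - (homogForm a).2 * (homogForm b).1) * this

theorem mdifferentiableOn_form (φ : LocalFraction E M) (a : OnePoint ℂ) :
    MDifferentiableOn 𝓘(ℂ, E) 𝓘(ℂ, ℂ) (φ.form a) φ.source :=
  (φ.holomorphic_num.const_smul (homogForm a).1).add (φ.holomorphic_den.const_smul (homogForm a).2)

end LocalFraction

namespace MeromorphicFunction

theorem Omits.num_den_eq_zero {f : MeromorphicFunction E M} {a : OnePoint ℂ} (h : f.Omits a)
    {φ : LocalFraction E M} (hφ : φ ∈ f.fractions) {x : M} (hx : x ∈ φ.source)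
    (h0 : φ.form a x = 0) : φ.num x = 0 ∧ φ.den x = 0 := by
  by_contra hcon
  have hdet : φ.IsDeterminateAt x := ⟨hx, by tauto⟩
  exact h x ⟨φ, hφ, hdet, LocalFraction.value_eq_of_form_eq_zero hdet h0⟩

/-- Cancelling a common factor in a local fraction of `f` gives a local fraction of `f`. -/
theorem exists_fraction_of_mul_eq (f : MeromorphicFunction E M) {φ : LocalFraction E M}
    (hφ : φ ∈ f.fractions) {W : Set M} (hW : IsOpen W) (hWs : W ⊆ φ.source) {k g h : M → ℂ}
    (hg : MDifferentiableOn 𝓘(ℂ, E) 𝓘(ℂ, ℂ) g W) (hh : MDifferentiableOn 𝓘(ℂ, E) 𝓘(ℂ, ℂ) h W)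
    (hm : ∀ x ∈ W, φ.num x = k x * g x ∧ φ.den x = k x * h x) :
    ∃ ψ ∈ f.fractions, ψ.source = W ∧ ψ.num = g ∧ ψ.den = h := by
  have hfreq : ∀ x ∈ W, ∃ᶠ y in 𝓝 x, y ∈ φ.source ∧ φ.den y ≠ 0 := fun x hx =>
    mem_closure_iff_frequently.1 (φ.dense_den_ne_zero (hWs hx))
  refine ⟨⟨W, g, h, hW, hg, hh, ?_⟩, f.maximal _ ?_, rfl, rfl, rfl⟩
  · intro x hx
    rw [mem_closure_iff_frequently]
    refine ((hfreq x hx).and_eventually (hW.mem_nhds hx)).mono fun y hy => ⟨hy.2, fun h0 => ?_⟩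
    exact hy.1.2 (by rw [(hm y hy.2).2, h0, mul_zero])
  · intro ψ hψ x hx
    change ψ.num x * h x = g x * ψ.den x
    have hxW : x ∈ W := hx.2
    have cont : ∀ {F : M → ℂ} {s : Set M}, IsOpen s → MDifferentiableOn 𝓘(ℂ, E) 𝓘(ℂ, ℂ) F s →
        x ∈ s → ContinuousAt F x := fun hs hF hxs => hF.continuousOn.continuousAt (hs.mem_nhds hxs)
    -- Compatibility holds where `φ.den ≠ 0`, since `k ≠ 0` there; such points are dense, so
    -- continuity extends it.
    by_contra hcon
    have hc := (((cont ψ.isOpen_source ψ.holomorphic_num hx.1).mul (cont hW hh hxW)).sub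
      ((cont hW hg hxW).mul (cont ψ.isOpen_source ψ.holomorphic_den hx.1))).eventually_ne
      (sub_ne_zero.2 hcon)
    obtain ⟨y, ⟨hys, hy0⟩, ⟨hyW, hyψ⟩, hy⟩ := ((hfreq x hxW).and_eventually
      ((hW.eventually_mem hxW).and (ψ.isOpen_source.eventually_mem hx.1) |>.and hc)).exists
    have e := f.compatible ψ hψ φ hφ y ⟨hyψ, hys⟩
    rw [(hm y hyW).1, (hm y hyW).2] at e
    have hk : k y ≠ 0 := fun hk => hy0 (by rw [(hm y hyW).2, hk, zero_mul])
    exact hy (mul_left_cancel₀ hk (by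
      change k y * (ψ.num y * h y - g y * ψ.den y) = k y * 0
      linear_combination e))

variable [FiniteDimensional ℂ E] [IsManifold 𝓘(ℂ, E) ω M]

/-- If `f` omits the value `b`, then near every point it has a local fraction on which the linear
form attached to `b` is `1`. In particular `f` has no points of indeterminacy. -/
theorem Omits.exists_form_eq_one {f : MeromorphicFunction E M} {a b : OnePoint ℂ} (hab : a ≠ b)
    (hb : f.Omits b) (p : M) :
    ∃ ψ ∈ f.fractions, p ∈ ψ.source ∧ ∀ x ∈ ψ.source, ψ.form b x = 1 := by
  obtain ⟨φ, hφ, hp⟩ := f.covers p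
  set s := (homogForm a).1 with hs
  set t := (homogForm a).2 with ht
  set s' := (homogForm b).1 with hs'
  set t' := (homogForm b).2 with ht'
  set D := s * t' - t * s' with hD
  have hD0 : D ≠ 0 := homogForm_det_ne_zero hab
  set χ := chartAt E p with hχ
  set W : Set E := χ.target ∩ χ.symm ⁻¹' φ.source with hWdef
  have hW : IsOpen W := χ.isOpen_inter_preimage_symm φ.isOpen_source
  have hpχ : p ∈ χ.source := mem_chart_source E p
  have hpW : χ p ∈ W := ⟨χ.map_source hpχ, by rw [mem_preimage, χ.left_inv hpχ]; exact hp⟩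
  have hpull : ∀ c : OnePoint ℂ, DifferentiableOn ℂ (fun y => φ.form c (χ.symm y)) W := by
    intro c y hy
    have h1 : MDifferentiableAt 𝓘(ℂ, E) 𝓘(ℂ, E) χ.symm y :=
      mdifferentiableAt_atlas_symm (chart_mem_atlas E p) hy.1
    have h2 := (φ.mdifferentiableOn_form c).mdifferentiableAt (φ.isOpen_source.mem_nhds hy.2)
    exact (mdifferentiableAt_iff_differentiableAt.1
      (MDifferentiableAt.comp (I' := 𝓘(ℂ, E)) y h2 h1)).differentiableWithinAt
  have hpush : ∀ {q : E → ℂ} {V : Set E}, IsOpen V → DifferentiableOn ℂ q V →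
      MDifferentiableOn 𝓘(ℂ, E) 𝓘(ℂ, ℂ) (fun x => q (χ x)) (χ.source ∩ χ ⁻¹' V) := by
    intro q V hV hq x hx
    have h1 : MDifferentiableAt 𝓘(ℂ, E) 𝓘(ℂ, E) χ x :=
      mdifferentiableAt_atlas (chart_mem_atlas E p) hx.1
    have h2 : MDifferentiableAt 𝓘(ℂ, E) 𝓘(ℂ, ℂ) q (χ x) :=
      ((hq _ hx.2).differentiableAt (hV.mem_nhds hx.2)).mdifferentiableAt
    exact (MDifferentiableAt.comp (I' := 𝓘(ℂ, E)) x h2 h1).mdifferentiableWithinAt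
  -- cancelling a common factor of the two linear forms
  have hred : ∀ V ⊆ W, IsOpen V → ∀ k u v : E → ℂ, DifferentiableOn ℂ u V →
      DifferentiableOn ℂ v V → (∀ y ∈ V, φ.form a (χ.symm y) = k y * u y ∧
        φ.form b (χ.symm y) = k y * v y) →
      ∃ ψ ∈ f.fractions, ψ.source = χ.source ∩ χ ⁻¹' V ∧ (∀ x, ψ.form a x = u (χ x)) ∧
        ∀ x, ψ.form b x = v (χ x) := by
    intro V hVW hV k u v hu hv hk
    obtain ⟨ψ, hψ, hsrc, hnum, hden⟩ := f.exists_fraction_of_mul_eq hφ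
      (χ.isOpen_inter_preimage hV) (k := fun x => k (χ x))
      -- Cramer's rule recovers numerator and denominator from the two forms.
      (g := fun x => (t' * u (χ x) - t * v (χ x)) / D)
      (h := fun x => (s * v (χ x) - s' * u (χ x)) / D)
      (fun x hx => by
        have := (hVW hx.2).2
        rwa [mem_preimage, χ.left_inv hx.1] at this)
      (hpush (q := fun y => (t' * u y - t * v y) / D) hV (by fun_prop))
      (hpush (q := fun y => (s * v y - s' * u y) / D) hV (by fun_prop))
      (fun x hx => by
        have h1 := hk _ hx.2
        rw [χ.left_inv hx.1] at h1
        simp only [LocalFraction.form, ← hs, ← ht, ← hs', ← ht'] at h1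
        constructor
        · field_simp
          linear_combination t' * h1.1 - t * h1.2
        · field_simp
          linear_combination s * h1.2 - s' * h1.1)
    refine ⟨ψ, hψ, hsrc, fun x => ?_, fun x => ?_⟩
    · simp only [LocalFraction.form, hnum, hden, ← hs, ← ht]
      field_simp
      ring
    · simp only [LocalFraction.form, hnum, hden, ← hs', ← ht']
      field_simp
      ring
  -- By maximality each reduction is again a fraction of `f`, so the omission of `b` applies to it
  -- too.
  have hpf : IsPoleFree (fun y => φ.form a (χ.symm y)) (fun y => φ.form b (χ.symm y)) W := by
    intro V hVW hV k u v hu hv hk y hy hvy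
    obtain ⟨ψ, hψ, hsrc, ha', hb'⟩ := hred V hVW hV k u v hu hv hk
    have hyt := (hVW hy).1
    have hys : χ.symm y ∈ ψ.source := by
      rw [hsrc]
      exact ⟨χ.map_target hyt, by rwa [mem_preimage, χ.right_inv hyt]⟩
    have h0 := hb.num_den_eq_zero hψ hys (by rw [hb', χ.right_inv hyt, hvy])
    have h1 := ha' (χ.symm y)
    rw [χ.right_inv hyt, LocalFraction.form, h0.1, h0.2] at h1
    simpa using h1.symm
  have hdense : W ⊆ closure {y | φ.form b (χ.symm y) ≠ 0} := by
    intro y hy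
    have h1 := mem_closure_iff_frequently.1 (φ.dense_den_ne_zero hy.2)
    rw [mem_closure_iff_frequently]
    have h2 := h1.and_eventually (χ.open_source.mem_nhds (χ.map_target hy.1))
    have hc : Tendsto χ (𝓝 (χ.symm y)) (𝓝 y) := by
      have := χ.continuousAt (χ.map_target hy.1)
      rwa [ContinuousAt, χ.right_inv hy.1] at this
    refine hc.frequently (h2.mono fun x hx h0 => ?_)
    rw [χ.left_inv hx.2] at h0
    exact hx.1.2 (hb.num_den_eq_zero hφ hx.1.1 h0).2
  obtain ⟨q, hq⟩ := hpf.locallyDivides hW (hpull a) (hpull b) hdense hpW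
  obtain ⟨V, hV, hVo, hpV⟩ := _root_.mem_nhds_iff.1 (Filter.inter_mem hq (hW.mem_nhds hpW))
  obtain ⟨ψ, hψ, hsrc, -, hb'⟩ := hred V (fun y hy => (hV hy).2) hVo
    (fun y => φ.form b (χ.symm y)) q (fun _ => 1)
    (fun y hy => (hV hy).1.1.differentiableWithinAt) (differentiableOn_const 1)
    (fun y hy => ⟨(hV hy).1.2.trans (mul_comm _ _), (mul_one _).symm⟩)
  exact ⟨ψ, hψ, by rw [hsrc]; exact ⟨hpχ, hpV⟩, fun x _ => hb' x⟩

/-- If `f` omits the value `b`, then its composition with the Möbius transformation given by the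
linear forms attached to `a` and `b` is a holomorphic function. -/
theorem Omits.exists_mdifferentiable_form_eq_mul {f : MeromorphicFunction E M} {a b : OnePoint ℂ}
    (hab : a ≠ b) (hb : f.Omits b) : ∃ Q : M → ℂ, MDifferentiable 𝓘(ℂ, E) 𝓘(ℂ, ℂ) Q ∧
      (∀ φ ∈ f.fractions, ∀ x ∈ φ.source, φ.form a x = Q x * φ.form b x) ∧
      ∀ x, ∃ φ ∈ f.fractions, x ∈ φ.source ∧ φ.form b x = 1 := by
  choose ψ hψ hmem hone using fun p => hb.exists_form_eq_one hab p
  have hQ : ∀ φ ∈ f.fractions, ∀ x ∈ φ.source,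
      φ.form a x = (ψ x).form a x * φ.form b x := by
    intro φ hφ x hx
    rw [← (f.compatible φ hφ _ (hψ x)).form_mul_form a b ⟨hx, hmem x⟩, hone x x (hmem x), mul_one]
  refine ⟨fun x => (ψ x).form a x, fun p => ?_, hQ, fun x => ⟨ψ x, hψ x, hmem x, hone x x (hmem x)⟩⟩
  refine (((ψ p).mdifferentiableOn_form a).mdifferentiableAt
    ((ψ p).isOpen_source.mem_nhds (hmem p))).congr_of_eventuallyEq ?_
  filter_upwards [(ψ p).isOpen_source.mem_nhds (hmem p)] with x hx
  rw [hQ _ (hψ p) x hx, hone p x hx, mul_one]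

end MeromorphicFunction

end Meromorphic

theorem mainTheorem6
    {E : Type*} [NormedAddCommGroup E] [NormedSpace ℂ E] [FiniteDimensional ℂ E]
    {G : Type*} [Group G] [TopologicalSpace G] [ChartedSpace E G]
    [LieGroup 𝓘(ℂ, E) ω G] [ConnectedSpace G]
    (f : MeromorphicFunction E G)
    (a₁ a₂ a₃ : OnePoint ℂ) (h₁₂ : a₁ ≠ a₂) (h₁₃ : a₁ ≠ a₃) (h₂₃ : a₂ ≠ a₃)
    (h₁ : f.Omits a₁) (h₂ : f.Omits a₂) (h₃ : f.Omits a₃) :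
    ∃ c : ℂ, f = MeromorphicFunction.const E G c := by
  obtain ⟨Q, hQ, hform, hex⟩ := h₃.exists_mdifferentiable_form_eq_mul h₁₃
  have d₁₂ := homogForm_det_ne_zero h₁₂
  have d₁₃ := homogForm_det_ne_zero h₁₃
  have d₂₃ := homogForm_det_ne_zero h₂₃
  set s₁ := (homogForm a₁).1
  set t₁ := (homogForm a₁).2
  set s₂ := (homogForm a₂).1
  set t₂ := (homogForm a₂).2
  set s₃ := (homogForm a₃).1
  set t₃ := (homogForm a₃).2
  -- With `Q = form a₁ / form a₃`, the linear relation between the three forms shows that `k * Q =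
  -- 1` exactly where `form a₂` vanishes, once `form a₃ = 1`.
  set k : ℂ := -((s₂ * t₃ - t₂ * s₃) / (s₁ * t₂ - t₁ * s₂)) with hk
  have hk0 : k ≠ 0 := neg_ne_zero.2 (div_ne_zero d₂₃ d₁₂)
  have homit : ∀ x, k * Q x ≠ 0 ∧ k * Q x ≠ 1 := by
    intro x
    obtain ⟨φ, hφ, hx, hone⟩ := hex x
    have hQx : φ.form a₁ x = Q x := by rw [hform φ hφ x hx, hone, mul_one]
    have hne : ¬(φ.num x = 0 ∧ φ.den x = 0) := fun h => by
      simp [LocalFraction.form, h.1, h.2] at hone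
    refine ⟨fun h => hne (h₁.num_den_eq_zero hφ hx ?_), fun h => hne (h₂.num_den_eq_zero hφ hx ?_)⟩
    · rw [hQx]; exact (mul_eq_zero.1 h).resolve_left hk0
    · have e : (s₂ * t₃ - t₂ * s₃) * φ.form a₁ x + (s₁ * t₂ - t₁ * s₂) * φ.form a₃ x =
          (s₁ * t₃ - t₁ * s₃) * φ.form a₂ x := by
        simp only [LocalFraction.form]; ring
      rw [hQx, hone] at e
      have hkd : k * (s₁ * t₂ - t₁ * s₂) = -(s₂ * t₃ - t₂ * s₃) := by
        rw [hk, neg_mul, div_mul_cancel₀ _ d₁₂]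
      refine (mul_eq_zero.1 (e.symm.trans ?_)).resolve_left d₁₃
      linear_combination Q x * hkd - (s₁ * t₂ - t₁ * s₂) * h
  obtain ⟨c', hc'⟩ := (show MDifferentiable 𝓘(ℂ, E) 𝓘(ℂ, ℂ) (fun x => k * Q x) from
    hQ.const_smul k).exists_eq_const_of_omits homit
  have hlin : ∀ φ ∈ f.fractions, ∀ x ∈ φ.source,
      (s₁ - c' / k * s₃) * φ.num x = (c' / k * t₃ - t₁) * φ.den x := by
    intro φ hφ x hx
    have e := hform φ hφ x hx
    have hq : Q x = c' / k := by rw [eq_div_iff hk0, mul_comm]; exact hc' x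
    rw [hq] at e
    simp only [LocalFraction.form] at e
    linear_combination e
  -- This excludes the constant `∞`: otherwise, at a point with `den ≠ 0`, both coefficients would
  -- vanish and the forms of `a₁` and `a₃` would be proportional.
  have hs0 : s₁ - c' / k * s₃ ≠ 0 := by
    intro h0
    obtain ⟨φ, hφ, hx⟩ := f.covers 1
    obtain ⟨y, hy⟩ := closure_nonempty_iff.1 ⟨1, φ.dense_den_ne_zero hx⟩
    have e := hlin φ hφ y hy.1
    rw [h0, zero_mul, zero_eq_mul] at e
    have h1 := e.resolve_right hy.2
    exact d₁₃ (by linear_combination t₃ * h0 + s₃ * h1)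
  have hle : ∀ φ ∈ f.fractions, ∀ x ∈ φ.source,
      φ.num x = (c' / k * t₃ - t₁) / (s₁ - c' / k * s₃) * φ.den x := by
    intro φ hφ x hx
    rw [div_mul_eq_mul_div, eq_div_iff hs0, mul_comm]
    exact hlin φ hφ x hx
  refine ⟨(c' / k * t₃ - t₁) / (s₁ - c' / k * s₃), MeromorphicFunction.ext (Set.Subset.antisymm hle ?_)⟩
  intro ψ hψ
  refine f.maximal ψ fun φ hφ x hx => ?_
  rw [hle φ hφ x hx.1, hψ x hx.2]
  ring
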